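/- Let $\mathcal A=\mathbb C\oplus\mathbb C\oplus\mathbb C\oplus\mathbb C\oplus M_2(\mathbb C)$, with minimal projections $e_1,e_2,e_3,e_4$ of the four one-dimensional summands and matrix units $a_{ij}$ $(i,j=1,2)$ of $M_2(\mathbb C)$, be the Kac–Paljutkin quantum group, i.e. the Hopf algebra with (writing $i=\sqrt{-1}$) $$\begin{aligned} \Delta(e_1)&=e_1\otimes e_1+e_2\otimes e_2+e_3\otimes e_3+e_4\otimes e_4+\tfrac12(a_{11}\otimes a_{11}+a_{12}\otimes a_{12}+a_{21}\otimes a_{21}+a_{22}\otimes a_{22}),\\ \Delta(e_2)&=e_1\otimes e_2+e_2\otimes e_1+e_3\otimes e_4+e_4\otimes e_3+\tfrac12(a_{11}\otimes a_{22}+a_{22}\otimes a_{11})-\tfrac i2a_{12}\otimes a_{21}+\tfrac i2a_{21}\otimes a_{12},\\ \Delta(e_3)&=e_1\otimes e_3+e_3\otimes e_1+e_2\otimes e_4+e_4\otimes e_2+\tfrac12(a_{11}\otimes a_{22}+a_{22}\otimes a_{11})+\tfrac i2a_{12}\otimes a_{21}-\tfrac i2a_{21}\otimes a_{12},\\ \Delta(e_4)&=e_1\otimes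 e_4+e_4\otimes e_1+e_2\otimes e_3+e_3\otimes e_2+\tfrac12(a_{11}\otimes a_{11}+a_{22}\otimes a_{22}-a_{12}\otimes a_{12}-a_{21}\otimes a_{21}),\\ \Delta(a_{11})&=e_1\otimes a_{11}+a_{11}\otimes e_1+e_2\otimes a_{22}+a_{22}\otimes e_2+e_3\otimes a_{22}+a_{22}\otimes e_3+e_4\otimes a_{11}+a_{11}\otimes e_4,\\ \Delta(a_{12})&=e_1\otimes a_{12}+a_{12}\otimes e_1+i\,e_2\otimes a_{21}-i\,a_{21}\otimes e_2-i\,e_3\otimes a_{21}+i\,a_{21}\otimes e_3-e_4\otimes a_{12}-a_{12}\otimes e_4,\\ \Delta(a_{21})&=e_1\otimes a_{21}+a_{21}\otimes e_1-i\,e_2\otimes a_{12}+i\,a_{12}\otimes e_2+i\,e_3\otimes a_{12}-i\,a_{12}\otimes e_3-e_4\otimes a_{21}-a_{21}\otimes e_4,\\ \Delta(a_{22})&=e_1\otimes a_{22}+a_{22}\otimes e_1+e_2\otimes a_{11}+a_{11}\otimes e_2+e_3\otimes a_{11}+a_{11}\otimes e_3+e_4\otimes a_{22}+a_{22}\otimes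 e_4, \end{aligned}$$ $\epsilon(e_1)=1$, $\epsilon(e_2)=\epsilon(e_3)=\epsilon(e_4)=\epsilon(a_{ij})=0$, $S(e_j)=e_j$, $S(a_{ij})=a_{ji}$. A unital left coideal subalgebra of a Hopf algebra $A$ is a unital subalgebra $L$ with $\Delta(L)\subseteq A\otimes L$. Its integral is the element $l\in L$ with $lx=xl=\epsilon(x)l$ for all $x\in L$ and $\epsilon(l)=1$ (unique if it exists). A solvable series is a strictly increasing chain $L_0\subsetneq L_1\subsetneq\dots\subsetneq L_n$ of unital left coideal subalgebras such that, for each $0\le j<n$, the integral $l_j$ of $L_j$ exists and lies in the centre of $L_{j+1}$, and $\bigl(a_{(1)}\,b\,S(a_{(2)})\bigr)l_j=\epsilon(a)\,b\,l_j$ for all $a,b\in L_{j+1}$, where $\Delta(a)=a_{(1)}\otimes a_{(2)}$ in Sweedler notation. Its length is its number $n+1$ of terms. In $\mathcal A$ put $$\begin{aligned} L_2&=\operatorname{span}\{e_1+e_2,\;e_3+e_4,\;a_{11}+a_{22},\;a_{12}-i\,a_{21}\},\\ L_3&=\operatorname{span}\{e_1+e_3,\;e_2+e_4,\;a_{11}+a_{22},\;a_{12}+i\,a_{21}\},\\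 L_4&=\operatorname{span}\{e_1+e_4,\;e_2+e_3,\;a_{11},\;a_{22}\},\\ L_5&=\operatorname{span}\{e_1+e_2+e_3+e_4,\;a_{11}+a_{22}\},\\ L_6&=\operatorname{span}\{e_1+e_4+a_{11},\;e_2+e_3+a_{22}\},\\ L_7&=\operatorname{span}\{e_1+e_4+a_{22},\;e_2+e_3+a_{11}\}. \end{aligned}$$ **Theorem.** The solvable series of length $4$ (four terms) of unital left coideal subalgebras of $\mathcal A$ are exactly the following five pairwise distinct chains: $\mathbb C1\subset L_5\subset L_2\subset\mathcal A$, $\mathbb C1\subset L_5\subset L_3\subset\mathcal A$, $\mathbb C1\subset L_5\subset L_4\subset\mathcal A$, $\mathbb C1\subset L_6\subset L_4\subset\mathcal A$ and $\mathbb C1\subset L_7\subset L_4\subset\mathcal A$. -/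

import Mathlib

open scoped TensorProduct

noncomputable section

/-! ### Solvable series of left coideal subalgebras of a Hopf algebra -/

section Hopf

variable {A : Type*} [Ring A] [HopfAlgebra ℂ A]

/-- A unital subalgebra `L` of a Hopf algebra `A` is a left coideal subalgebra if
`Δ(L) ⊆ A ⊗ L`, where `A ⊗ L` is regarded as a subspace of `A ⊗ A`. -/
def IsLeftCoidealSubalgebra (L : Subalgebra ℂ A) : Prop :=
  ∀ x ∈ L, Coalgebra.comul (R := ℂ) x ∈
    LinearMap.range (LinearMap.lTensor A (Subalgebra.toSubmodule L).subtype)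

/-- The left adjoint action `a₍₁₎ b S(a₍₂₎)`. -/
def hopfAd (a b : A) : A :=
  LinearMap.mul' ℂ A
    (TensorProduct.map (LinearMap.mulRight ℂ b) (HopfAlgebra.antipode ℂ)
      (Coalgebra.comul (R := ℂ) a))

/-- `l` is the normalized integral of `L`: `l ∈ L`, `l x = x l = ε(x) l` for all `x ∈ L`,
and `ε(l) = 1`. There is at most one such element, see `IsNormalizedIntegral.unique`. -/
structure IsNormalizedIntegral (L : Subalgebra ℂ A) (l : A) : Prop where
  mem : l ∈ L
  mul_right : ∀ x ∈ L, l * x = Coalgebra.counit (R := ℂ) x • l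
  mul_left : ∀ x ∈ L, x * l = Coalgebra.counit (R := ℂ) x • l
  counit_eq_one : Coalgebra.counit (R := ℂ) l = 1

theorem IsNormalizedIntegral.unique {L : Subalgebra ℂ A} {l l' : A}
    (h : IsNormalizedIntegral L l) (h' : IsNormalizedIntegral L l') : l = l' := by
  have h1 := h.mul_right l' h'.mem
  have h2 := h'.mul_left l h.mem
  rw [h'.counit_eq_one, one_smul] at h1
  rw [h.counit_eq_one, one_smul] at h2
  rw [← h1, h2]

/-- A strictly increasing chain `L₀ ⊂ L₁ ⊂ ⋯ ⊂ Lₙ` of unital left coideal subalgebras is a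
solvable series if, for every `j < n`, the integral `l` of `Lⱼ` lies in the centre of `Lⱼ₊₁`,
and `(a₍₁₎ b S(a₍₂₎)) l = ε(a) b l` for all `a, b ∈ Lⱼ₊₁`. -/
structure IsSolvableSeries {n : ℕ} (L : Fin (n + 1) → Subalgebra ℂ A) : Prop where
  leftCoideal : ∀ j, IsLeftCoidealSubalgebra (L j)
  strictMono : StrictMono L
  step : ∀ j : Fin n, ∃ l : A, IsNormalizedIntegral (L j.castSucc) l ∧
    (l ∈ L j.succ ∧ ∀ x ∈ L j.succ, l * x = x * l) ∧
    ∀ a ∈ L j.succ, ∀ b ∈ L j.succ,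
      hopfAd a b * l = Coalgebra.counit (R := ℂ) a • (b * l)

end Hopf

/-! ### The Kac–Paljutkin quantum group -/

/-- The algebra `ℂ ⊕ ℂ ⊕ ℂ ⊕ ℂ ⊕ M₂(ℂ)` underlying the Kac–Paljutkin quantum group. -/
def KacPaljutkin : Type := (Fin 4 → ℂ) × Matrix (Fin 2) (Fin 2) ℂ

namespace KacPaljutkin

instance : Ring KacPaljutkin :=
  inferInstanceAs (Ring ((Fin 4 → ℂ) × Matrix (Fin 2) (Fin 2) ℂ))

instance : Algebra ℂ KacPaljutkin :=
  inferInstanceAs (Algebra ℂ ((Fin 4 → ℂ) × Matrix (Fin 2) (Fin 2) ℂ))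

/-- The minimal projection of the `i`-th one-dimensional summand (`i = 0, 1, 2, 3`). -/
def e (i : Fin 4) : KacPaljutkin := (Pi.single i 1, 0)

/-- The matrix unit of `M₂(ℂ)` in row `i` and column `j` (`i, j = 0, 1`). -/
def a (i j : Fin 2) : KacPaljutkin := (0, Matrix.single i j 1)

def e1 : KacPaljutkin := e 0
def e2 : KacPaljutkin := e 1
def e3 : KacPaljutkin := e 2
def e4 : KacPaljutkin := e 3
def a11 : KacPaljutkin := a 0 0
def a12 : KacPaljutkin := a 0 1
def a21 : KacPaljutkin := a 1 0
def a22 : KacPaljutkin := a 1 1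

/-- The linear map with prescribed values on the basis
`e1, e2, e3, e4, a11, a12, a21, a22`. -/
def lift {M : Type*} [AddCommGroup M] [Module ℂ M] (v1 v2 v3 v4 w11 w12 w21 w22 : M) :
    KacPaljutkin →ₗ[ℂ] M where
  toFun x := x.1 0 • v1 + x.1 1 • v2 + x.1 2 • v3 + x.1 3 • v4 +
    x.2 0 0 • w11 + x.2 0 1 • w12 + x.2 1 0 • w21 + x.2 1 1 • w22
  map_add' x y := by
    change (x.1 0 + y.1 0) • v1 + (x.1 1 + y.1 1) • v2 + (x.1 2 + y.1 2) • v3 +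
      (x.1 3 + y.1 3) • v4 + (x.2 0 0 + y.2 0 0) • w11 + (x.2 0 1 + y.2 0 1) • w12 +
      (x.2 1 0 + y.2 1 0) • w21 + (x.2 1 1 + y.2 1 1) • w22 = _
    module
  map_smul' c x := by
    change (c * x.1 0) • v1 + (c * x.1 1) • v2 + (c * x.1 2) • v3 +
      (c * x.1 3) • v4 + (c * x.2 0 0) • w11 + (c * x.2 0 1) • w12 +
      (c * x.2 1 0) • w21 + (c * x.2 1 1) • w22 = c • _
    module

section lift
variable {M : Type*} [AddCommGroup M] [Module ℂ M] (v1 v2 v3 v4 w11 w12 w21 w22 : M)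

theorem lift_e1 : lift v1 v2 v3 v4 w11 w12 w21 w22 (e 0) = v1 := by
  simp [lift, e]
theorem lift_e2 : lift v1 v2 v3 v4 w11 w12 w21 w22 (e 1) = v2 := by
  simp [lift, e]
theorem lift_e3 : lift v1 v2 v3 v4 w11 w12 w21 w22 (e 2) = v3 := by
  simp [lift, e]
theorem lift_e4 : lift v1 v2 v3 v4 w11 w12 w21 w22 (e 3) = v4 := by
  simp [lift, e]
theorem lift_a11 : lift v1 v2 v3 v4 w11 w12 w21 w22 (a 0 0) = w11 := by
  simp [lift, a]
theorem lift_a12 : lift v1 v2 v3 v4 w11 w12 w21 w22 (a 0 1) = w12 := by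
  simp [lift, a]
theorem lift_a21 : lift v1 v2 v3 v4 w11 w12 w21 w22 (a 1 0) = w21 := by
  simp [lift, a]
theorem lift_a22 : lift v1 v2 v3 v4 w11 w12 w21 w22 (a 1 1) = w22 := by
  simp [lift, a]

end lift

theorem lift_basis (x : KacPaljutkin) :
    lift e1 e2 e3 e4 a11 a12 a21 a22 x = x := by
  refine Prod.ext ?_ ?_
  · change x.1 0 • Pi.single 0 1 + x.1 1 • Pi.single 1 1 + x.1 2 • Pi.single 2 1 +
      x.1 3 • Pi.single 3 1 + x.2 0 0 • (0 : Fin 4 → ℂ) + x.2 0 1 • (0 : Fin 4 → ℂ) +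
      x.2 1 0 • (0 : Fin 4 → ℂ) + x.2 1 1 • (0 : Fin 4 → ℂ) = x.1
    ext i
    fin_cases i <;> simp
  · change x.1 0 • (0 : Matrix (Fin 2) (Fin 2) ℂ) + x.1 1 • (0 : Matrix (Fin 2) (Fin 2) ℂ) +
      x.1 2 • (0 : Matrix (Fin 2) (Fin 2) ℂ) + x.1 3 • (0 : Matrix (Fin 2) (Fin 2) ℂ) +
      x.2 0 0 • Matrix.single 0 0 1 + x.2 0 1 • Matrix.single 0 1 1 +
      x.2 1 0 • Matrix.single 1 0 1 + x.2 1 1 • Matrix.single 1 1 1 = x.2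
    ext i j
    fin_cases i <;> fin_cases j <;> simp

theorem hom_ext {M : Type*} [AddCommGroup M] [Module ℂ M] {f g : KacPaljutkin →ₗ[ℂ] M}
    (h1 : f e1 = g e1) (h2 : f e2 = g e2) (h3 : f e3 = g e3) (h4 : f e4 = g e4)
    (h11 : f a11 = g a11) (h12 : f a12 = g a12) (h21 : f a21 = g a21) (h22 : f a22 = g a22) :
    f = g := by
  ext x
  rw [← lift_basis x]
  simp only [lift, LinearMap.coe_mk, AddHom.coe_mk, map_add, map_smul, h1, h2, h3, h4, h11,
    h12, h21, h22]

theorem one_eq : (1 : KacPaljutkin) = e1 + e2 + e3 + e4 + a11 + a22 := by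
  conv_lhs => rw [← lift_basis 1]
  have h1 : ∀ i, (1 : KacPaljutkin).1 i = 1 := fun _ => rfl
  have h2 : (1 : KacPaljutkin).2 = 1 := rfl
  simp [lift, h1, h2]

/-! The multiplication table. -/

theorem e_mul_e (i j : Fin 4) : e i * e j = if i = j then e i else 0 := by
  change (Pi.single i 1 * Pi.single j 1, (0 : Matrix (Fin 2) (Fin 2) ℂ) * 0) = _
  split_ifs with h
  · subst h
    simp [e, ← Pi.single_mul]
  · have h0 : (Pi.single i 1 * Pi.single j 1 : Fin 4 → ℂ) = 0 := by
      ext k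
      by_cases hk : k = i
      · subst hk
        simp [h]
      · simp [hk]
    rw [mul_zero, h0]
    rfl

theorem e_mul_a (i : Fin 4) (j k : Fin 2) : e i * a j k = 0 := by
  change (Pi.single i 1 * 0, (0 : Matrix (Fin 2) (Fin 2) ℂ) * _) = _
  rw [mul_zero, zero_mul]
  rfl

theorem a_mul_e (i : Fin 4) (j k : Fin 2) : a j k * e i = 0 := by
  change (0 * Pi.single i 1, _ * (0 : Matrix (Fin 2) (Fin 2) ℂ)) = _
  rw [mul_zero, zero_mul]
  rfl

theorem a_mul_a (i j k l : Fin 2) : a i j * a k l = if j = k then a i l else 0 := by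
  change ((0 : Fin 4 → ℂ) * 0, Matrix.single i j (1 : ℂ) * Matrix.single k l 1) = _
  split_ifs with h
  · subst h
    simp [a]
  · rw [mul_zero, Matrix.single_mul_single_of_ne _ _ _ _ h]
    rfl

/-! ### The Hopf algebra structure -/

open Complex in
/-- The comultiplication. -/
def comulMap : KacPaljutkin →ₗ[ℂ] KacPaljutkin ⊗[ℂ] KacPaljutkin :=
  lift
    -- Δ(e1)
    (e1 ⊗ₜ e1 + e2 ⊗ₜ e2 + e3 ⊗ₜ e3 + e4 ⊗ₜ e4
      + (1 / 2 : ℂ) • a11 ⊗ₜ a11 + (1 / 2 : ℂ) • a12 ⊗ₜ a12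
      + (1 / 2 : ℂ) • a21 ⊗ₜ a21 + (1 / 2 : ℂ) • a22 ⊗ₜ a22)
    -- Δ(e2)
    (e1 ⊗ₜ e2 + e2 ⊗ₜ e1 + e3 ⊗ₜ e4 + e4 ⊗ₜ e3
      + (1 / 2 : ℂ) • a11 ⊗ₜ a22 + (1 / 2 : ℂ) • a22 ⊗ₜ a11
      - (I / 2) • a12 ⊗ₜ a21 + (I / 2) • a21 ⊗ₜ a12)
    -- Δ(e3)
    (e1 ⊗ₜ e3 + e3 ⊗ₜ e1 + e2 ⊗ₜ e4 + e4 ⊗ₜ e2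
      + (1 / 2 : ℂ) • a11 ⊗ₜ a22 + (1 / 2 : ℂ) • a22 ⊗ₜ a11
      + (I / 2) • a12 ⊗ₜ a21 - (I / 2) • a21 ⊗ₜ a12)
    -- Δ(e4)
    (e1 ⊗ₜ e4 + e4 ⊗ₜ e1 + e2 ⊗ₜ e3 + e3 ⊗ₜ e2
      + (1 / 2 : ℂ) • a11 ⊗ₜ a11 + (1 / 2 : ℂ) • a22 ⊗ₜ a22
      - (1 / 2 : ℂ) • a12 ⊗ₜ a12 - (1 / 2 : ℂ) • a21 ⊗ₜ a21)
    -- Δ(a11)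
    (e1 ⊗ₜ a11 + a11 ⊗ₜ e1 + e2 ⊗ₜ a22 + a22 ⊗ₜ e2
      + e3 ⊗ₜ a22 + a22 ⊗ₜ e3 + e4 ⊗ₜ a11 + a11 ⊗ₜ e4)
    -- Δ(a12)
    (e1 ⊗ₜ a12 + a12 ⊗ₜ e1 + I • e2 ⊗ₜ a21 - I • a21 ⊗ₜ e2
      - I • e3 ⊗ₜ a21 + I • a21 ⊗ₜ e3 - e4 ⊗ₜ a12 - a12 ⊗ₜ e4)
    -- Δ(a21)
    (e1 ⊗ₜ a21 + a21 ⊗ₜ e1 - I • e2 ⊗ₜ a12 + I • a12 ⊗ₜ e2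
      + I • e3 ⊗ₜ a12 - I • a12 ⊗ₜ e3 - e4 ⊗ₜ a21 - a21 ⊗ₜ e4)
    -- Δ(a22)
    (e1 ⊗ₜ a22 + a22 ⊗ₜ e1 + e2 ⊗ₜ a11 + a11 ⊗ₜ e2
      + e3 ⊗ₜ a11 + a11 ⊗ₜ e3 + e4 ⊗ₜ a22 + a22 ⊗ₜ e4)

/-- The counit: `ε(e1) = 1` and `ε` vanishes on the other basis elements. -/
def counitMap : KacPaljutkin →ₗ[ℂ] ℂ := lift 1 0 0 0 0 0 0 0

/-- The antipode: `S(eᵢ) = eᵢ` and `S(aᵢⱼ) = aⱼᵢ`. -/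
def antipodeMap : KacPaljutkin →ₗ[ℂ] KacPaljutkin := lift e1 e2 e3 e4 a11 a21 a12 a22

instance : Coalgebra ℂ KacPaljutkin where
  comul := comulMap
  counit := counitMap
  coassoc := by
    apply hom_ext <;>
      simp only [comulMap, e1, e2, e3, e4, a11, a12, a21, a22, LinearMap.comp_apply, lift_e1,
        lift_e2, lift_e3, lift_e4, lift_a11, lift_a12, lift_a21, lift_a22, map_add, map_sub,
        map_smul, LinearMap.rTensor_tmul, LinearMap.lTensor_tmul, LinearEquiv.coe_coe,
        TensorProduct.add_tmul, TensorProduct.sub_tmul, TensorProduct.tmul_add,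
        TensorProduct.tmul_sub, ← TensorProduct.smul_tmul', TensorProduct.tmul_smul,
        TensorProduct.assoc_tmul] <;>
      match_scalars <;> ring_nf <;> simp [Complex.I_sq] <;> norm_num
  rTensor_counit_comp_comul := by
    apply hom_ext <;>
      simp [comulMap, counitMap, e1, e2, e3, e4, a11, a12, a21, a22, lift_e1,
        lift_e2, lift_e3, lift_e4, lift_a11, lift_a12, lift_a21, lift_a22]
  lTensor_counit_comp_comul := by
    apply hom_ext <;>
      simp [comulMap, counitMap, e1, e2, e3, e4, a11, a12, a21, a22, lift_e1,
        lift_e2, lift_e3, lift_e4, lift_a11, lift_a12, lift_a21, lift_a22]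

theorem comul_one : comulMap 1 = 1 := by
  rw [Algebra.TensorProduct.one_def, one_eq]
  simp only [comulMap, e1, e2, e3, e4, a11, a22, lift_e1,
    lift_e2, lift_e3, lift_e4, lift_a11, lift_a22, map_add,
    TensorProduct.add_tmul, TensorProduct.tmul_add]
  module

set_option maxHeartbeats 4000000 in
theorem comul_mul (x y : KacPaljutkin) : comulMap (x * y) = comulMap x * comulMap y := by
  suffices h : (LinearMap.mul ℂ KacPaljutkin).compr₂ comulMap =
      (LinearMap.mul ℂ (KacPaljutkin ⊗[ℂ] KacPaljutkin)).compl₁₂ comulMap comulMap from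
    DFunLike.congr_fun (DFunLike.congr_fun h x) y
  apply hom_ext <;> apply hom_ext <;>
    simp only [LinearMap.compr₂_apply, LinearMap.compl₁₂_apply, LinearMap.mul_apply',
      comulMap, e1, e2, e3, e4, a11, a12, a21, a22, e_mul_e, e_mul_a, a_mul_e, a_mul_a,
      lift_e1, lift_e2, lift_e3, lift_e4, lift_a11, lift_a12, lift_a21, lift_a22, map_zero,
      mul_add, add_mul, mul_sub, sub_mul, smul_mul_assoc, mul_smul_comm,
      Algebra.TensorProduct.tmul_mul_tmul, TensorProduct.tmul_zero, TensorProduct.zero_tmul,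
      smul_zero, reduceIte, Fin.reduceEq, add_zero, zero_add, sub_zero, zero_sub] <;>
    match_scalars <;> ring_nf <;> simp [Complex.I_sq] <;> norm_num

theorem counit_mul (x y : KacPaljutkin) :
    counitMap (x * y) = counitMap x * counitMap y := by
  have h : (x * y).1 0 = x.1 0 * y.1 0 := rfl
  simp [counitMap, lift, h]

instance : Bialgebra ℂ KacPaljutkin :=
  Bialgebra.mk' ℂ KacPaljutkin
    (by
      change counitMap 1 = 1
      rw [one_eq]
      simp [counitMap, e1, e2, e3, e4, a11, a22, lift_e1, lift_e2, lift_e3, lift_e4,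
        lift_a11, lift_a22])
    (counit_mul _ _) comul_one (comul_mul _ _)

instance : HopfAlgebra ℂ KacPaljutkin where
  antipode := antipodeMap
  mul_antipode_rTensor_comul := by
    change LinearMap.mul' ℂ _ ∘ₗ antipodeMap.rTensor _ ∘ₗ comulMap =
      Algebra.linearMap ℂ _ ∘ₗ counitMap
    apply hom_ext <;>
      simp only [LinearMap.comp_apply, Algebra.linearMap_apply, Algebra.algebraMap_eq_smul_one,
        one_eq, comulMap, counitMap, antipodeMap, e1, e2, e3, e4, a11, a12, a21, a22,
        lift_e1, lift_e2, lift_e3, lift_e4, lift_a11, lift_a12, lift_a21, lift_a22, map_add,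
        map_sub, map_smul, LinearMap.rTensor_tmul, LinearMap.mul'_apply, e_mul_e, e_mul_a,
        a_mul_e, a_mul_a, reduceIte, Fin.reduceEq] <;>
      match_scalars <;> ring_nf
  mul_antipode_lTensor_comul := by
    change LinearMap.mul' ℂ _ ∘ₗ antipodeMap.lTensor _ ∘ₗ comulMap =
      Algebra.linearMap ℂ _ ∘ₗ counitMap
    apply hom_ext <;>
      simp only [LinearMap.comp_apply, Algebra.linearMap_apply, Algebra.algebraMap_eq_smul_one,
        one_eq, comulMap, counitMap, antipodeMap, e1, e2, e3, e4, a11, a12, a21, a22,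
        lift_e1, lift_e2, lift_e3, lift_e4, lift_a11, lift_a12, lift_a21, lift_a22, map_add,
        map_sub, map_smul, LinearMap.lTensor_tmul, LinearMap.mul'_apply, e_mul_e, e_mul_a,
        a_mul_e, a_mul_a, reduceIte, Fin.reduceEq] <;>
      match_scalars <;> ring_nf

/-! ### The left coideal subalgebras `L₂, …, L₇`

The remaining two are `L₁ = ⊤` and `L₈ = ℂ1 = ⊥`. -/

/-- The linear span of `s`, as a subalgebra. -/
def spanSubalgebra (s : Set KacPaljutkin) (h1 : 1 ∈ Submodule.span ℂ s)
    (hmul : ∀ x ∈ s, ∀ y ∈ s, x * y ∈ Submodule.span ℂ s) : Subalgebra ℂ KacPaljutkin :=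
  (Submodule.span ℂ s).toSubalgebra h1 fun x y hx hy => by
    have h : Submodule.span ℂ s * Submodule.span ℂ s ≤ Submodule.span ℂ s := by
      rw [Submodule.span_mul_span, Submodule.span_le]
      rintro _ ⟨u, hu, v, hv, rfl⟩
      exact hmul u hu v hv
    exact h (Submodule.mul_mem_mul hx hy)

theorem mem_span_of_eq_smul {s : Set KacPaljutkin} {x : KacPaljutkin} (c : ℂ)
    (y : KacPaljutkin) (hy : y ∈ s) (h : x = c • y) : x ∈ Submodule.span ℂ s :=
  h ▸ Submodule.smul_mem _ c (Submodule.subset_span hy)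

theorem mem_span_of_eq_zero {s : Set KacPaljutkin} {x : KacPaljutkin} (h : x = 0) :
    x ∈ Submodule.span ℂ s :=
  h ▸ Submodule.zero_mem _

set_option linter.unusedSimpArgs false
set_option linter.unreachableTactic false
set_option linter.unusedTactic false

/-- The subalgebra `L₂`. -/
def L2 : Subalgebra ℂ KacPaljutkin :=
  spanSubalgebra {e1 + e2, e3 + e4, a11 + a22, a12 - Complex.I • a21}
    (by
      have h : (1 : KacPaljutkin) = (e1 + e2) + (e3 + e4) + (a11 + a22) := by
        rw [one_eq]; abel
      rw [h]
      exact Submodule.add_mem _ (Submodule.add_mem _ (Submodule.subset_span (by simp))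
        (Submodule.subset_span (by simp)))
        (Submodule.subset_span (by simp)))
    (by
      intro x hx y hy
      have h : x * y = 0 ∨ x * y = (1 : ℂ) • x ∨ x * y = (1 : ℂ) • y ∨
          x * y = (-Complex.I) • (a11 + a22) := by
        rcases hx with rfl | rfl | rfl | rfl <;> rcases hy with rfl | rfl | rfl | rfl <;>
          simp only [e1, e2, e3, e4, a11, a12, a21, a22, mul_add, add_mul, mul_sub, sub_mul,
          smul_mul_assoc, mul_smul_comm, e_mul_e, e_mul_a, a_mul_e, a_mul_a, reduceIte,
          Fin.reduceEq, smul_zero, add_zero, zero_add, sub_zero, zero_sub] <;>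
        first
        | (left; simp <;> fail)
        | (right; left; match_scalars <;> simp <;> fail)
        | (right; right; left; match_scalars <;> simp <;> fail)
        | (right; right; right; match_scalars <;> simp <;> fail)
      rcases h with h | h | h | h
      · exact mem_span_of_eq_zero h
      · exact mem_span_of_eq_smul _ _ hx h
      · exact mem_span_of_eq_smul _ _ hy h
      · exact mem_span_of_eq_smul _ _ (by simp) h)

/-- The subalgebra `L₃`. -/
def L3 : Subalgebra ℂ KacPaljutkin :=
  spanSubalgebra {e1 + e3, e2 + e4, a11 + a22, a12 + Complex.I • a21}
    (by
      have h : (1 : KacPaljutkin) = (e1 + e3) + (e2 + e4) + (a11 + a22) := by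
        rw [one_eq]; abel
      rw [h]
      exact Submodule.add_mem _ (Submodule.add_mem _ (Submodule.subset_span (by simp))
        (Submodule.subset_span (by simp)))
        (Submodule.subset_span (by simp)))
    (by
      intro x hx y hy
      have h : x * y = 0 ∨ x * y = (1 : ℂ) • x ∨ x * y = (1 : ℂ) • y ∨
          x * y = Complex.I • (a11 + a22) := by
        rcases hx with rfl | rfl | rfl | rfl <;> rcases hy with rfl | rfl | rfl | rfl <;>
          simp only [e1, e2, e3, e4, a11, a12, a21, a22, mul_add, add_mul, mul_sub, sub_mul,
          smul_mul_assoc, mul_smul_comm, e_mul_e, e_mul_a, a_mul_e, a_mul_a, reduceIte,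
          Fin.reduceEq, smul_zero, add_zero, zero_add, sub_zero, zero_sub] <;>
        first
        | (left; simp <;> fail)
        | (right; left; match_scalars <;> simp <;> fail)
        | (right; right; left; match_scalars <;> simp <;> fail)
        | (right; right; right; match_scalars <;> simp <;> fail)
      rcases h with h | h | h | h
      · exact mem_span_of_eq_zero h
      · exact mem_span_of_eq_smul _ _ hx h
      · exact mem_span_of_eq_smul _ _ hy h
      · exact mem_span_of_eq_smul _ _ (by simp) h)

/-- The subalgebra `L₄`. -/
def L4 : Subalgebra ℂ KacPaljutkin :=
  spanSubalgebra {e1 + e4, e2 + e3, a11, a22}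
    (by
      have h : (1 : KacPaljutkin) = (e1 + e4) + (e2 + e3) + (a11) + (a22) := by
        rw [one_eq]; abel
      rw [h]
      exact Submodule.add_mem _ (Submodule.add_mem _ (Submodule.add_mem _ (Submodule.subset_span (by simp))
        (Submodule.subset_span (by simp)))
        (Submodule.subset_span (by simp)))
        (Submodule.subset_span (by simp)))
    (by
      intro x hx y hy
      have h : x * y = 0 ∨ x * y = (1 : ℂ) • x := by
        rcases hx with rfl | rfl | rfl | rfl <;> rcases hy with rfl | rfl | rfl | rfl <;>
          simp only [e1, e2, e3, e4, a11, a12, a21, a22, mul_add, add_mul, mul_sub, sub_mul,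
          smul_mul_assoc, mul_smul_comm, e_mul_e, e_mul_a, a_mul_e, a_mul_a, reduceIte,
          Fin.reduceEq, smul_zero, add_zero, zero_add, sub_zero, zero_sub] <;>
        first
        | (left; simp <;> fail)
        | (right; match_scalars <;> simp <;> fail)
      rcases h with h | h
      · exact mem_span_of_eq_zero h
      · exact mem_span_of_eq_smul _ _ hx h)

/-- The subalgebra `L₅`. -/
def L5 : Subalgebra ℂ KacPaljutkin :=
  spanSubalgebra {e1 + e2 + e3 + e4, a11 + a22}
    (by
      have h : (1 : KacPaljutkin) = (e1 + e2 + e3 + e4) + (a11 + a22) := by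
        rw [one_eq]; abel
      rw [h]
      exact Submodule.add_mem _ (Submodule.subset_span (by simp))
        (Submodule.subset_span (by simp)))
    (by
      intro x hx y hy
      have h : x * y = 0 ∨ x * y = (1 : ℂ) • x := by
        rcases hx with rfl | rfl <;> rcases hy with rfl | rfl <;>
          simp only [e1, e2, e3, e4, a11, a12, a21, a22, mul_add, add_mul, mul_sub, sub_mul,
          smul_mul_assoc, mul_smul_comm, e_mul_e, e_mul_a, a_mul_e, a_mul_a, reduceIte,
          Fin.reduceEq, smul_zero, add_zero, zero_add, sub_zero, zero_sub] <;>
        first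
        | (left; simp <;> fail)
        | (right; match_scalars <;> simp <;> fail)
      rcases h with h | h
      · exact mem_span_of_eq_zero h
      · exact mem_span_of_eq_smul _ _ hx h)

/-- The subalgebra `L₆`. -/
def L6 : Subalgebra ℂ KacPaljutkin :=
  spanSubalgebra {e1 + e4 + a11, e2 + e3 + a22}
    (by
      have h : (1 : KacPaljutkin) = (e1 + e4 + a11) + (e2 + e3 + a22) := by
        rw [one_eq]; abel
      rw [h]
      exact Submodule.add_mem _ (Submodule.subset_span (by simp))
        (Submodule.subset_span (by simp)))
    (by
      intro x hx y hy
      have h : x * y = 0 ∨ x * y = (1 : ℂ) • x := by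
        rcases hx with rfl | rfl <;> rcases hy with rfl | rfl <;>
          simp only [e1, e2, e3, e4, a11, a12, a21, a22, mul_add, add_mul, mul_sub, sub_mul,
          smul_mul_assoc, mul_smul_comm, e_mul_e, e_mul_a, a_mul_e, a_mul_a, reduceIte,
          Fin.reduceEq, smul_zero, add_zero, zero_add, sub_zero, zero_sub] <;>
        first
        | (left; simp <;> fail)
        | (right; match_scalars <;> simp <;> fail)
      rcases h with h | h
      · exact mem_span_of_eq_zero h
      · exact mem_span_of_eq_smul _ _ hx h)

/-- The subalgebra `L₇`. -/
def L7 : Subalgebra ℂ KacPaljutkin :=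
  spanSubalgebra {e1 + e4 + a22, e2 + e3 + a11}
    (by
      have h : (1 : KacPaljutkin) = (e1 + e4 + a22) + (e2 + e3 + a11) := by
        rw [one_eq]; abel
      rw [h]
      exact Submodule.add_mem _ (Submodule.subset_span (by simp))
        (Submodule.subset_span (by simp)))
    (by
      intro x hx y hy
      have h : x * y = 0 ∨ x * y = (1 : ℂ) • x := by
        rcases hx with rfl | rfl <;> rcases hy with rfl | rfl <;>
          simp only [e1, e2, e3, e4, a11, a12, a21, a22, mul_add, add_mul, mul_sub, sub_mul,
          smul_mul_assoc, mul_smul_comm, e_mul_e, e_mul_a, a_mul_e, a_mul_a, reduceIte,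
          Fin.reduceEq, smul_zero, add_zero, zero_add, sub_zero, zero_sub] <;>
        first
        | (left; simp <;> fail)
        | (right; match_scalars <;> simp <;> fail)
      rcases h with h | h
      · exact mem_span_of_eq_zero h
      · exact mem_span_of_eq_smul _ _ hx h)

end KacPaljutkin
end

/-! ### A basis of group-likes and matrix coefficients -/

namespace KacPaljutkin

/-! As a coalgebra, the Kac–Paljutkin algebra is the sum of four lines, spanned by the group-likes
`1, g, h, k` (a Klein four-group), and one 2×2 matrix coalgebra with entries `c11, c12, c21, c22`.
The key point is that every left coideal subalgebra `L` is spanned by a subset of this basis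
(`exists_toSubmodule_eq_coordSubmodule`). Slicing `Δ(x)` along the first tensor factor isolates the
group-like components of `x`. In the matrix block it only gives pairs `u • c11 + v • c12`, `u • c21
+ v • c22`. If `u` and `v` are both nonzero, the product of such a pair is a combination of `h` and
`k` with nonzero coefficients (`row_mul_row`), so `h` and `k` lie in `L`, and multiplying by them
separates the matrix coefficients (`matrixCoeff_mem_of_row_mem`).

Closure under products and coproducts then leaves eight index sets, and a finite check of their
inclusions gives exactly five strict chains with four terms, all running from `⊥` to `⊤`.

It remains to see that all five are solvable, for which two mechanisms suffice. If the integral of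
`L` is a sum of some of `e1, …, e4`, it is central, and multiplication by it is governed by
characters, which trivialize the adjoint action (`AlgHom.map_hopfAd`, `isSolvableStep_of_sum_e`). If
the larger algebra is contained in `L4`, which is commutative and spanned by group-likes, then the
adjoint action itself is trivial there (`isSolvableStep_of_le_L4`). -/

/-- The nontrivial central group-like element. -/
def g : KacPaljutkin := e1 + e2 + e3 + e4 - a11 - a22

/-- The group-like element spanning `L₆` together with `1`. -/
def h : KacPaljutkin := e1 - e2 - e3 + e4 + a11 - a22

/-- The group-like element spanning `L₇` together with `1`. -/
def k : KacPaljutkin := e1 - e2 - e3 + e4 - a11 + a22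

/-- The `(1, 1)` entry of the two-dimensional matrix coalgebra in `KacPaljutkin`. -/
def c11 : KacPaljutkin := e1 + e2 - e3 - e4

/-- The `(1, 2)` entry of the two-dimensional matrix coalgebra in `KacPaljutkin`. -/
def c12 : KacPaljutkin := a12 + Complex.I • a21

/-- The `(2, 1)` entry of the two-dimensional matrix coalgebra in `KacPaljutkin`. -/
def c21 : KacPaljutkin := a12 - Complex.I • a21

/-- The `(2, 2)` entry of the two-dimensional matrix coalgebra in `KacPaljutkin`. -/
def c22 : KacPaljutkin := e1 - e2 + e3 - e4

/-- The basis of group-like elements and matrix coefficients. -/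
def cobasis : Fin 8 → KacPaljutkin := ![1, g, h, k, c11, c12, c21, c22]

open Complex in
/-- The coordinates with respect to `cobasis`. -/
noncomputable def coord : KacPaljutkin →ₗ[ℂ] Fin 8 → ℂ :=
  lift ![1 / 8, 1 / 8, 1 / 8, 1 / 8, 1 / 4, 0, 0, 1 / 4]
    ![1 / 8, 1 / 8, -1 / 8, -1 / 8, 1 / 4, 0, 0, -1 / 4]
    ![1 / 8, 1 / 8, -1 / 8, -1 / 8, -1 / 4, 0, 0, 1 / 4]
    ![1 / 8, 1 / 8, 1 / 8, 1 / 8, -1 / 4, 0, 0, -1 / 4]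
    ![1 / 4, -1 / 4, 1 / 4, -1 / 4, 0, 0, 0, 0]
    ![0, 0, 0, 0, 0, 1 / 2, 1 / 2, 0]
    ![0, 0, 0, 0, 0, -I / 2, I / 2, 0]
    ![1 / 4, -1 / 4, -1 / 4, 1 / 4, 0, 0, 0, 0]

theorem coord_e1 : coord e1 = ![1 / 8, 1 / 8, 1 / 8, 1 / 8, 1 / 4, 0, 0, 1 / 4] := lift_e1 ..
theorem coord_e2 : coord e2 = ![1 / 8, 1 / 8, -1 / 8, -1 / 8, 1 / 4, 0, 0, -1 / 4] := lift_e2 ..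
theorem coord_e3 : coord e3 = ![1 / 8, 1 / 8, -1 / 8, -1 / 8, -1 / 4, 0, 0, 1 / 4] := lift_e3 ..
theorem coord_e4 : coord e4 = ![1 / 8, 1 / 8, 1 / 8, 1 / 8, -1 / 4, 0, 0, -1 / 4] := lift_e4 ..
theorem coord_a11 : coord a11 = ![1 / 4, -1 / 4, 1 / 4, -1 / 4, 0, 0, 0, 0] := lift_a11 ..
theorem coord_a12 : coord a12 = ![0, 0, 0, 0, 0, 1 / 2, 1 / 2, 0] := lift_a12 ..
theorem coord_a21 : coord a21 = ![0, 0, 0, 0, 0, -Complex.I / 2, Complex.I / 2, 0] := lift_a21 ..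
theorem coord_a22 : coord a22 = ![1 / 4, -1 / 4, -1 / 4, 1 / 4, 0, 0, 0, 0] := lift_a22 ..

theorem coord_cobasis (i : Fin 8) : coord (cobasis i) = Pi.single i 1 := by
  have hI : Complex.I * (Complex.I / 2) = -1 / 2 := by
    rw [← mul_div_assoc, Complex.I_mul_I]
  have hI' : Complex.I * (-Complex.I / 2) = 1 / 2 := by
    rw [← mul_div_assoc, mul_neg, Complex.I_mul_I, neg_neg]
  fin_cases i <;> ext j <;> fin_cases j <;>
    simp [cobasis, one_eq, g, h, k, c11, c12, c21, c22, coord_e1, coord_e2, coord_e3, coord_e4,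
      coord_a11, coord_a12, coord_a21, coord_a22, hI, hI'] <;> norm_num

theorem sum_coord_smul_cobasis (x : KacPaljutkin) : ∑ i, coord x i • cobasis i = x := by
  have key : (Fintype.linearCombination ℂ cobasis).comp coord = LinearMap.id := by
    apply hom_ext <;>
      simp only [LinearMap.comp_apply, Fintype.linearCombination_apply, coord_e1, coord_e2,
        coord_e3, coord_e4, coord_a11, coord_a12, coord_a21, coord_a22, Fin.sum_univ_eight,
        LinearMap.id_apply] <;>
      simp [cobasis, one_eq, g, h, k, c11, c12, c21, c22] <;> match_scalars <;> ring_nf <;>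
      simp [Complex.I_sq]
  exact DFunLike.congr_fun key x

/-- The span of a part of `cobasis`, described by vanishing coordinates. -/
def coordSubmodule (S : Finset (Fin 8)) : Submodule ℂ KacPaljutkin where
  carrier := {x | ∀ i ∉ S, coord x i = 0}
  add_mem' hx hy i hi := by simp [hx i hi, hy i hi]
  zero_mem' i _ := by simp
  smul_mem' c x hx i hi := by simp [hx i hi]

theorem mem_coordSubmodule {S : Finset (Fin 8)} {x : KacPaljutkin} :
    x ∈ coordSubmodule S ↔ ∀ i ∉ S, coord x i = 0 := Iff.rfl

theorem cobasis_mem_coordSubmodule {S : Finset (Fin 8)} {i : Fin 8} :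
    cobasis i ∈ coordSubmodule S ↔ i ∈ S := by
  simp only [mem_coordSubmodule, coord_cobasis]
  refine ⟨fun H => ?_, fun hi j hj => Pi.single_eq_of_ne (by rintro rfl; exact hj hi) _⟩
  by_contra hi
  simpa using H i hi

/-- Expanding in `cobasis` kills the terms outside `S`, so containment only has to be tested on
finitely many basis elements. -/
theorem coordSubmodule_le_iff {S : Finset (Fin 8)} {M : Submodule ℂ KacPaljutkin} :
    coordSubmodule S ≤ M ↔ ∀ i ∈ S, cobasis i ∈ M := by
  refine ⟨fun H i hi => H (cobasis_mem_coordSubmodule.2 hi), fun H x hx => ?_⟩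
  rw [← sum_coord_smul_cobasis x]
  refine M.sum_mem fun i _ => ?_
  by_cases hi : i ∈ S
  · exact M.smul_mem _ (H i hi)
  · rw [hx i hi, zero_smul]
    exact M.zero_mem

theorem coordSubmodule_le_coordSubmodule {S T : Finset (Fin 8)} :
    coordSubmodule S ≤ coordSubmodule T ↔ S ⊆ T := by
  simp only [coordSubmodule_le_iff, cobasis_mem_coordSubmodule, Finset.subset_iff]

/-! ### The subalgebras of the statement as coordinate subspaces -/

theorem toSubmodule_L2 : Subalgebra.toSubmodule L2 = coordSubmodule {0, 1, 4, 6} := by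
  change Submodule.span ℂ _ = _
  apply le_antisymm
  · rw [Submodule.span_le]
    rintro x (rfl | rfl | rfl | rfl) i <;> fin_cases i <;>
      simp [coord_e1, coord_e2, coord_e3, coord_e4, coord_a11, coord_a12, coord_a21, coord_a22] <;>
      ring_nf <;> simp [Complex.I_sq]
  · rw [coordSubmodule_le_iff]
    -- Reduces each membership below to naming four coefficients. These are the values of the basis
    -- element on the blocks of the spanning set, for example `1, 1, -1, 0` for `g`.
    have H : ∀ u v w t : ℂ, u • (e1 + e2) + v • (e3 + e4) + w • (a11 + a22) +
        t • (a12 - Complex.I • a21) ∈ Submodule.span ℂ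
          {e1 + e2, e3 + e4, a11 + a22, a12 - Complex.I • a21} := fun u v w t => by
      simp only [Submodule.mem_span_insert, Submodule.mem_span_singleton]
      exact ⟨u, _, ⟨v, _, ⟨w, _, ⟨t, rfl⟩, rfl⟩, rfl⟩, by abel⟩
    intro i hi
    fin_cases i <;> simp at hi
    · convert H 1 1 1 0; simp [cobasis, one_eq]; abel
    · convert H 1 1 (-1) 0; simp [cobasis, g]; abel
    · convert H 1 (-1) 0 0; simp [cobasis, c11]; abel
    · convert H 0 0 0 1; simp [cobasis, c21]

theorem toSubmodule_L3 : Subalgebra.toSubmodule L3 = coordSubmodule {0, 1, 5, 7} := by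
  change Submodule.span ℂ _ = _
  apply le_antisymm
  · rw [Submodule.span_le]
    rintro x (rfl | rfl | rfl | rfl) i <;> fin_cases i <;>
      simp [coord_e1, coord_e2, coord_e3, coord_e4, coord_a11, coord_a12, coord_a21, coord_a22] <;>
      ring_nf <;> simp [Complex.I_sq]
  · rw [coordSubmodule_le_iff]
    have H : ∀ u v w t : ℂ, u • (e1 + e3) + v • (e2 + e4) + w • (a11 + a22) +
        t • (a12 + Complex.I • a21) ∈ Submodule.span ℂ
          {e1 + e3, e2 + e4, a11 + a22, a12 + Complex.I • a21} := fun u v w t => by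
      simp only [Submodule.mem_span_insert, Submodule.mem_span_singleton]
      exact ⟨u, _, ⟨v, _, ⟨w, _, ⟨t, rfl⟩, rfl⟩, rfl⟩, by abel⟩
    intro i hi
    fin_cases i <;> simp at hi
    · convert H 1 1 1 0; simp [cobasis, one_eq]; abel
    · convert H 1 1 (-1) 0; simp [cobasis, g]; abel
    · convert H 0 0 0 1; simp [cobasis, c12]
    · convert H 1 (-1) 0 0; simp [cobasis, c22]; abel

theorem toSubmodule_L4 : Subalgebra.toSubmodule L4 = coordSubmodule {0, 1, 2, 3} := by
  change Submodule.span ℂ _ = _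
  apply le_antisymm
  · rw [Submodule.span_le]
    rintro x (rfl | rfl | rfl | rfl) i <;> fin_cases i <;>
      simp [coord_e1, coord_e2, coord_e3, coord_e4, coord_a11, coord_a22] <;>
      ring_nf
  · rw [coordSubmodule_le_iff]
    have H : ∀ u v w t : ℂ, u • (e1 + e4) + v • (e2 + e3) + w • a11 + t • a22 ∈
        Submodule.span ℂ {e1 + e4, e2 + e3, a11, a22} := fun u v w t => by
      simp only [Submodule.mem_span_insert, Submodule.mem_span_singleton]
      exact ⟨u, _, ⟨v, _, ⟨w, _, ⟨t, rfl⟩, rfl⟩, rfl⟩, by abel⟩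
    intro i hi
    fin_cases i <;> simp at hi
    · convert H 1 1 1 1; simp [cobasis, one_eq]; abel
    · convert H 1 1 (-1) (-1); simp [cobasis, g]; abel
    · convert H 1 (-1) 1 (-1); simp [cobasis, h]; abel
    · convert H 1 (-1) (-1) 1; simp [cobasis, k]; abel

theorem toSubmodule_L5 : Subalgebra.toSubmodule L5 = coordSubmodule {0, 1} := by
  change Submodule.span ℂ _ = _
  apply le_antisymm
  · rw [Submodule.span_le]
    rintro x (rfl | rfl) i <;> fin_cases i <;>
      simp [coord_e1, coord_e2, coord_e3, coord_e4, coord_a11, coord_a22] <;> ring_nf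
  · rw [coordSubmodule_le_iff]
    intro i hi
    rw [Submodule.mem_span_pair]
    fin_cases i <;> simp at hi
    · exact ⟨1, 1, by simp [cobasis, one_eq]; abel⟩
    · exact ⟨1, -1, by simp [cobasis, g]; abel⟩

theorem toSubmodule_L6 : Subalgebra.toSubmodule L6 = coordSubmodule {0, 2} := by
  change Submodule.span ℂ _ = _
  apply le_antisymm
  · rw [Submodule.span_le]
    rintro x (rfl | rfl) i <;> fin_cases i <;>
      simp [coord_e1, coord_e2, coord_e3, coord_e4, coord_a11, coord_a22] <;> ring_nf
  · rw [coordSubmodule_le_iff]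
    intro i hi
    rw [Submodule.mem_span_pair]
    fin_cases i <;> simp at hi
    · exact ⟨1, 1, by simp [cobasis, one_eq]; abel⟩
    · exact ⟨1, -1, by simp [cobasis, h]; abel⟩

theorem toSubmodule_L7 : Subalgebra.toSubmodule L7 = coordSubmodule {0, 3} := by
  change Submodule.span ℂ _ = _
  apply le_antisymm
  · rw [Submodule.span_le]
    rintro x (rfl | rfl) i <;> fin_cases i <;>
      simp [coord_e1, coord_e2, coord_e3, coord_e4, coord_a11, coord_a22] <;> ring_nf
  · rw [coordSubmodule_le_iff]
    intro i hi
    rw [Submodule.mem_span_pair]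
    fin_cases i <;> simp at hi
    · exact ⟨1, 1, by simp [cobasis, one_eq]; abel⟩
    · exact ⟨1, -1, by simp [cobasis, k]; abel⟩

theorem toSubmodule_bot_eq_coordSubmodule :
    Subalgebra.toSubmodule (⊥ : Subalgebra ℂ KacPaljutkin) = coordSubmodule {0} := by
  rw [Algebra.toSubmodule_bot, Submodule.one_eq_span]
  apply le_antisymm
  · rw [Submodule.span_singleton_le_iff_mem]
    exact cobasis_mem_coordSubmodule (i := 0).2 (by simp)
  · rw [coordSubmodule_le_iff]
    intro i hi
    rw [Finset.mem_singleton.1 hi]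
    exact Submodule.mem_span_singleton_self _

theorem toSubmodule_top_eq_coordSubmodule :
    Subalgebra.toSubmodule (⊤ : Subalgebra ℂ KacPaljutkin) = coordSubmodule Finset.univ :=
  le_antisymm (fun _ _ i hi => absurd (Finset.mem_univ i) hi) fun _ _ => trivial

end KacPaljutkin

/-! ### Slices of the comultiplication -/

/-- `Δ(x)` comes from `A ⊗ L`, so evaluating a functional on the first factor leaves a combination
of elements of `L`. -/
theorem IsLeftCoidealSubalgebra.slice_mem {A : Type*} [Ring A] [HopfAlgebra ℂ A]
    {L : Subalgebra ℂ A} (hL : IsLeftCoidealSubalgebra L) (f : A →ₗ[ℂ] ℂ) {x : A} (hx : x ∈ L) :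
    TensorProduct.lid ℂ A (f.rTensor A (Coalgebra.comul (R := ℂ) x)) ∈ L := by
  obtain ⟨t, ht⟩ := hL x hx
  rw [← ht]
  clear ht
  induction t with
  | zero => simp
  | tmul u v => simpa using L.smul_mem v.2 (f u)
  | add s t hs ht => simpa using L.add_mem hs ht

namespace KacPaljutkin

theorem comul_cobasis (i : Fin 8) :
    Coalgebra.comul (R := ℂ) (cobasis i) =
      ![1 ⊗ₜ 1, g ⊗ₜ g, h ⊗ₜ h, k ⊗ₜ k, c11 ⊗ₜ c11 + c12 ⊗ₜ c21, c11 ⊗ₜ c12 + c12 ⊗ₜ c22,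
        c21 ⊗ₜ c11 + c22 ⊗ₜ c21, c21 ⊗ₜ c12 + c22 ⊗ₜ c22] i := by
  change comulMap (cobasis i) = _
  fin_cases i
  · exact comul_one
  all_goals
    simp only [cobasis, Matrix.cons_val, Fin.reduceFinMk, Fin.mk_one, g, h, k, c11, c12, c21, c22,
      comulMap, e1, e2, e3, e4, a11, a12, a21, a22, lift_e1, lift_e2, lift_e3, lift_e4, lift_a11,
      lift_a12, lift_a21, lift_a22, map_add, map_sub, map_smul,
      TensorProduct.add_tmul, TensorProduct.sub_tmul, TensorProduct.tmul_add,
      TensorProduct.tmul_sub, ← TensorProduct.smul_tmul', TensorProduct.tmul_smul]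
    match_scalars <;> ring_nf <;> simp [Complex.I_sq]

/-- The components of `Δ(x)` along `cobasis` in the first tensor factor. -/
noncomputable def slice (x : KacPaljutkin) : Fin 8 → KacPaljutkin :=
  ![coord x 0 • 1, coord x 1 • g, coord x 2 • h, coord x 3 • k,
    coord x 4 • c11 + coord x 5 • c12, coord x 4 • c21 + coord x 5 • c22,
    coord x 6 • c11 + coord x 7 • c12, coord x 6 • c21 + coord x 7 • c22]

theorem comul_eq_sum_slice (x : KacPaljutkin) :
    Coalgebra.comul (R := ℂ) x = ∑ i, cobasis i ⊗ₜ[ℂ] slice x i := by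
  conv_lhs => rw [← sum_coord_smul_cobasis x]
  simp only [map_sum, map_smul, comul_cobasis]
  simp only [Fin.sum_univ_eight, slice, cobasis, Matrix.cons_val, TensorProduct.tmul_add,
    TensorProduct.tmul_smul]
  module

/-- The first factors of `comul_eq_sum_slice` form a basis, and the dual coordinate functionals
recover the individual slices. -/
theorem isLeftCoidealSubalgebra_iff {L : Subalgebra ℂ KacPaljutkin} :
    IsLeftCoidealSubalgebra L ↔ ∀ x ∈ L, ∀ i, slice x i ∈ L := by
  constructor
  · intro hL x hx i
    have H := hL.slice_mem ((LinearMap.proj i).comp coord) hx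
    simpa [comul_eq_sum_slice, coord_cobasis, Pi.single_apply, ite_smul] using H
  · intro H x hx
    rw [comul_eq_sum_slice]
    refine Submodule.sum_mem _ fun i _ => ⟨cobasis i ⊗ₜ ⟨slice x i, H x hx i⟩, ?_⟩
    simp

/-! Products of basis elements. -/

theorem g_mul_h : g * h = k := by
  simp only [g, h, k, e1, e2, e3, e4, a11, a22, mul_add, add_mul, mul_sub, sub_mul, e_mul_e,
    e_mul_a, a_mul_e, a_mul_a, reduceIte, Fin.reduceEq]
  module

theorem g_mul_k : g * k = h := by
  simp only [g, h, k, e1, e2, e3, e4, a11, a22, mul_add, add_mul, mul_sub, sub_mul, e_mul_e,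
    e_mul_a, a_mul_e, a_mul_a, reduceIte, Fin.reduceEq]
  module

theorem h_mul_k : h * k = g := by
  simp only [g, h, k, e1, e2, e3, e4, a11, a22, mul_add, add_mul, mul_sub, sub_mul, e_mul_e,
    e_mul_a, a_mul_e, a_mul_a, reduceIte, Fin.reduceEq]
  module

theorem h_mul_c11 : h * c11 = c22 := by
  simp only [h, c11, c22, e1, e2, e3, e4, a11, a22, mul_add, add_mul, mul_sub, sub_mul, e_mul_e,
    a_mul_e, reduceIte, Fin.reduceEq]
  module

theorem h_mul_c22 : h * c22 = c11 := by
  simp only [h, c11, c22, e1, e2, e3, e4, a11, a22, mul_add, add_mul, mul_sub, sub_mul, e_mul_e,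
    a_mul_e, reduceIte, Fin.reduceEq]
  module

theorem h_mul_c12 : h * c12 = c21 := by
  simp only [h, c12, c21, e1, e2, e3, e4, a11, a12, a21, a22, mul_add, add_mul, sub_mul,
    mul_smul_comm, e_mul_a, a_mul_a, reduceIte, Fin.reduceEq]
  module

theorem h_mul_c21 : h * c21 = c12 := by
  simp only [h, c12, c21, e1, e2, e3, e4, a11, a12, a21, a22, mul_sub, add_mul, sub_mul,
    mul_smul_comm, e_mul_a, a_mul_a, reduceIte, Fin.reduceEq]
  module

theorem k_mul_c11 : k * c11 = c22 := by
  simp only [k, c11, c22, e1, e2, e3, e4, a11, a22, mul_add, add_mul, mul_sub, sub_mul, e_mul_e,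
    a_mul_e, reduceIte, Fin.reduceEq]
  module

theorem k_mul_c12 : k * c12 = -c21 := by
  simp only [k, c12, c21, e1, e2, e3, e4, a11, a12, a21, a22, mul_add, add_mul, sub_mul,
    mul_smul_comm, e_mul_a, a_mul_a, reduceIte, Fin.reduceEq]
  module

theorem c11_mul_c11 : c11 * c11 = (1 / 2 : ℂ) • (1 + g) := by
  simp only [g, one_eq, c11, e1, e2, e3, e4, a11, a22, mul_add, add_mul, mul_sub, sub_mul,
    e_mul_e, reduceIte, Fin.reduceEq]
  module

theorem c22_mul_c22 : c22 * c22 = (1 / 2 : ℂ) • (1 + g) := by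
  simp only [g, one_eq, c22, e1, e2, e3, e4, a11, a22, mul_add, add_mul, mul_sub, sub_mul,
    e_mul_e, reduceIte, Fin.reduceEq]
  module

/-- The coefficients of `h` and `k` are nonzero multiples of `u * v`. This is what rules out left
coideal subalgebras meeting the matrix block in a skew direction. -/
theorem row_mul_row (u v : ℂ) :
    (u • c11 + v • c12) * (u • c21 + v • c22) =
      (u * v) • ((1 / 2 - Complex.I / 2) • h + (1 / 2 + Complex.I / 2) • k) := by
  simp only [h, k, c11, c12, c21, c22, e1, e2, e3, e4, a11, a12, a21, a22, mul_add, add_mul,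
    mul_sub, sub_mul, smul_mul_assoc, mul_smul_comm, e_mul_e, e_mul_a, a_mul_e, a_mul_a,
    reduceIte, Fin.reduceEq]
  match_scalars <;> ring_nf

/-! ### Left coideal subalgebras contain the basis elements they involve -/

theorem mem_of_smul_mem {L : Subalgebra ℂ KacPaljutkin} {c : ℂ} (hc : c ≠ 0)
    {x : KacPaljutkin} (hx : c • x ∈ L) : x ∈ L := by
  simpa [smul_smul, inv_mul_cancel₀ hc] using L.smul_mem hx c⁻¹

/-- The square of `c11` is the projection `(1 + g) / 2` onto the four one-dimensional summands. -/
theorem g_mem_of_c11_mem {L : Subalgebra ℂ KacPaljutkin} (H : c11 ∈ L) : g ∈ L := by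
  have h1 := L.mul_mem H H
  rw [c11_mul_c11] at h1
  simpa using L.sub_mem (mem_of_smul_mem (by norm_num) h1) L.one_mem

theorem g_mem_of_c22_mem {L : Subalgebra ℂ KacPaljutkin} (H : c22 ∈ L) : g ∈ L := by
  have h1 := L.mul_mem H H
  rw [c22_mul_c22] at h1
  simpa using L.sub_mem (mem_of_smul_mem (by norm_num) h1) L.one_mem

theorem cobasis_mem_of_coord_ne_zero_of_lt {L : Subalgebra ℂ KacPaljutkin}
    (hL : IsLeftCoidealSubalgebra L) {x : KacPaljutkin} (hx : x ∈ L) {i : Fin 8} (hi : i < 4)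
    (hc : coord x i ≠ 0) : cobasis i ∈ L := by
  have H := isLeftCoidealSubalgebra_iff.1 hL x hx i
  refine mem_of_smul_mem hc ?_
  fin_cases i <;> first | exact H | simp at hi

theorem h_mem_and_k_mem_of_row_mem {L : Subalgebra ℂ KacPaljutkin}
    (hL : IsLeftCoidealSubalgebra L) {u v : ℂ} (hu : u ≠ 0) (hv : v ≠ 0)
    (h1 : u • c11 + v • c12 ∈ L) (h2 : u • c21 + v • c22 ∈ L) : h ∈ L ∧ k ∈ L := by
  have H := L.mul_mem h1 h2
  rw [row_mul_row] at H
  have H' := mem_of_smul_mem (mul_ne_zero hu hv) H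
  have e2 : h = cobasis 2 := rfl
  have e3 : k = cobasis 3 := rfl
  rw [e2, e3] at H' ⊢
  constructor
  -- Both coefficients `(1 ∓ i) / 2` are nonzero, so each of the two group-likes can be extracted.
  · refine cobasis_mem_of_coord_ne_zero_of_lt hL H' (by decide) ?_
    simp only [map_add, map_smul, coord_cobasis]
    simp [Complex.ext_iff]
  · refine cobasis_mem_of_coord_ne_zero_of_lt hL H' (by decide) ?_
    simp only [map_add, map_smul, coord_cobasis]
    simp [Complex.ext_iff]

theorem matrixCoeff_mem_of_row_mem {L : Subalgebra ℂ KacPaljutkin}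
    (hL : IsLeftCoidealSubalgebra L) {u v : ℂ}
    (h1 : u • c11 + v • c12 ∈ L) (h2 : u • c21 + v • c22 ∈ L) :
    (u ≠ 0 → c11 ∈ L ∧ c21 ∈ L) ∧ (v ≠ 0 → c12 ∈ L ∧ c22 ∈ L) := by
  by_cases hu : u = 0
  · subst hu
    simp only [zero_smul, zero_add] at h1 h2
    exact ⟨fun H => absurd rfl H, fun hv => ⟨mem_of_smul_mem hv h1, mem_of_smul_mem hv h2⟩⟩
  by_cases hv : v = 0
  · subst hv
    simp only [zero_smul, add_zero] at h1 h2
    exact ⟨fun hu => ⟨mem_of_smul_mem hu h1, mem_of_smul_mem hu h2⟩, fun H => absurd rfl H⟩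
  -- With `u` and `v` nonzero, `h` and `k` send the first row to `u • c22 + v • c21` and `u • c22 -
  -- v • c21`. The sum isolates `c22` and the difference isolates `c21`; multiplying these by `h`
  -- gives `c11` and `c12`.
  obtain ⟨hh, hk⟩ := h_mem_and_k_mem_of_row_mem hL hu hv h1 h2
  have h3 := L.mul_mem hh h1
  have h4 := L.mul_mem hk h1
  simp only [mul_add, mul_smul_comm, h_mul_c11, h_mul_c12, k_mul_c11, k_mul_c12] at h3 h4
  have h22 : c22 ∈ L := by
    refine mem_of_smul_mem (c := 2 * u) (by simpa) ?_
    convert L.add_mem h3 h4 using 1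
    module
  have h21 : c21 ∈ L := by
    refine mem_of_smul_mem (c := 2 * v) (by simpa) ?_
    convert L.sub_mem h3 h4 using 1
    module
  have h11 := L.mul_mem hh h22
  have h12 := L.mul_mem hh h21
  rw [h_mul_c22] at h11
  rw [h_mul_c21] at h12
  exact ⟨fun _ => ⟨h11, h21⟩, fun _ => ⟨h12, h22⟩⟩

theorem cobasis_mem_of_coord_ne_zero {L : Subalgebra ℂ KacPaljutkin}
    (hL : IsLeftCoidealSubalgebra L) {x : KacPaljutkin} (hx : x ∈ L) {i : Fin 8}
    (hc : coord x i ≠ 0) : cobasis i ∈ L := by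
  have H := isLeftCoidealSubalgebra_iff.1 hL x hx
  have H1 := matrixCoeff_mem_of_row_mem hL (H 4) (H 5)
  have H2 := matrixCoeff_mem_of_row_mem hL (H 6) (H 7)
  by_cases hi : i < 4
  · exact cobasis_mem_of_coord_ne_zero_of_lt hL hx hi hc
  fin_cases i
  iterate 4 exact absurd (by decide) hi
  · exact (H1.1 hc).1
  · exact (H1.2 hc).1
  · exact (H2.1 hc).2
  · exact (H2.2 hc).2

/-- `c11` and `c21` form a column of the matrix coalgebra, and each occurs as a slice of the other.
-/
theorem c11_mem_iff {L : Subalgebra ℂ KacPaljutkin}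
    (hL : IsLeftCoidealSubalgebra L) : c11 ∈ L ↔ c21 ∈ L := by
  constructor
  · intro hx
    have H := isLeftCoidealSubalgebra_iff.1 hL c11 hx 5
    simpa [slice, show c11 = cobasis 4 from rfl, coord_cobasis] using H
  · intro hx
    have H := isLeftCoidealSubalgebra_iff.1 hL c21 hx 6
    simpa [slice, show c21 = cobasis 6 from rfl, coord_cobasis] using H

theorem c12_mem_iff {L : Subalgebra ℂ KacPaljutkin}
    (hL : IsLeftCoidealSubalgebra L) : c12 ∈ L ↔ c22 ∈ L := by
  constructor
  · intro hx
    have H := isLeftCoidealSubalgebra_iff.1 hL c12 hx 5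
    simpa [slice, show c12 = cobasis 5 from rfl, coord_cobasis] using H
  · intro hx
    have H := isLeftCoidealSubalgebra_iff.1 hL c22 hx 6
    simpa [slice, show c22 = cobasis 7 from rfl, coord_cobasis] using H

/-! ### Classification of the left coideal subalgebras -/

/-- The index sets of the parts of `cobasis` that span left coideal subalgebras. -/
def coidealIndexSets : Finset (Finset (Fin 8)) :=
  {{0}, {0, 1}, {0, 2}, {0, 3}, {0, 1, 2, 3}, {0, 1, 4, 6}, {0, 1, 5, 7}, Finset.univ}

-- The hypotheses record the closure properties found above: the Klein four-group relations, the
-- columns of the matrix coalgebra, the squares of `c11` and `c22`, and the exchange of these two by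
-- `h`. They are tested on all 256 subsets.
set_option maxRecDepth 10000 in
theorem mem_coidealIndexSets_of_closed : ∀ S : Finset (Fin 8),
    ((0 ∈ S ∧ (1 ∈ S → 2 ∈ S → 3 ∈ S) ∧ (1 ∈ S → 3 ∈ S → 2 ∈ S) ∧ (2 ∈ S → 3 ∈ S → 1 ∈ S)) ∧
    ((4 ∈ S ↔ 6 ∈ S) ∧ (5 ∈ S ↔ 7 ∈ S) ∧ (4 ∈ S → 1 ∈ S) ∧ (7 ∈ S → 1 ∈ S)) ∧
    (2 ∈ S → (4 ∈ S ↔ 7 ∈ S)) ∧ (4 ∈ S → 7 ∈ S → 2 ∈ S)) → S ∈ coidealIndexSets := by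
  decide +kernel

open Classical in
/-- The classification of the left coideal subalgebras of `KacPaljutkin`. -/
theorem exists_toSubmodule_eq_coordSubmodule {L : Subalgebra ℂ KacPaljutkin}
    (hL : IsLeftCoidealSubalgebra L) :
    ∃ S ∈ coidealIndexSets, Subalgebra.toSubmodule L = coordSubmodule S := by
  refine ⟨Finset.univ.filter fun i => cobasis i ∈ L, ?_, ?_⟩
  · refine mem_coidealIndexSets_of_closed _ ?_
    simp only [Finset.mem_filter, Finset.mem_univ, true_and]
    change ((1 ∈ L ∧ (g ∈ L → h ∈ L → k ∈ L) ∧ (g ∈ L → k ∈ L → h ∈ L) ∧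
      (h ∈ L → k ∈ L → g ∈ L)) ∧ ((c11 ∈ L ↔ c21 ∈ L) ∧ (c12 ∈ L ↔ c22 ∈ L) ∧
      (c11 ∈ L → g ∈ L) ∧ (c22 ∈ L → g ∈ L)) ∧ (h ∈ L → (c11 ∈ L ↔ c22 ∈ L)) ∧
      (c11 ∈ L → c22 ∈ L → h ∈ L))
    refine ⟨⟨L.one_mem, fun h1 h2 => g_mul_h ▸ L.mul_mem h1 h2,
      fun h1 h2 => g_mul_k ▸ L.mul_mem h1 h2, fun h1 h2 => h_mul_k ▸ L.mul_mem h1 h2⟩,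
      ⟨c11_mem_iff hL, c12_mem_iff hL, g_mem_of_c11_mem, g_mem_of_c22_mem⟩,
      fun hh => ⟨fun H => h_mul_c11 ▸ L.mul_mem hh H, fun H => h_mul_c22 ▸ L.mul_mem hh H⟩,
      -- `c11` and `c22` bring in both columns, so the rows with `u = v = 1` are available.
      fun h4 h7 => (h_mem_and_k_mem_of_row_mem hL one_ne_zero one_ne_zero ?_ ?_).1⟩
    · simpa using L.add_mem h4 ((c12_mem_iff hL).2 h7)
    · simpa using L.add_mem ((c11_mem_iff hL).1 h4) h7
  · apply le_antisymm
    · intro x hx i hi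
      by_contra hc
      exact hi (by simpa using cobasis_mem_of_coord_ne_zero hL hx hc)
    · rw [coordSubmodule_le_iff]
      intro i hi
      simpa using hi

end KacPaljutkin

/-! ### The adjoint action and solvable steps in a general Hopf algebra -/

/-- A character of a Hopf algebra trivializes the left adjoint action. -/
theorem AlgHom.map_hopfAd {A : Type*} [Ring A] [HopfAlgebra ℂ A] (χ : A →ₐ[ℂ] ℂ) (a b : A) :
    χ (hopfAd a b) = Coalgebra.counit (R := ℂ) a * χ b := by
  -- Values of `χ` commute, so `χ b` can be pulled out from between the two tensor factors; the
  -- antipode axiom then applies to what remains.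
  have key : ∀ t : A ⊗[ℂ] A,
      χ (LinearMap.mul' ℂ A
        (TensorProduct.map (LinearMap.mulRight ℂ b) (HopfAlgebra.antipode ℂ) t)) =
      χ (LinearMap.mul' ℂ A ((HopfAlgebra.antipode ℂ).lTensor A t)) * χ b := fun t => by
    induction t with
    | zero => simp
    | tmul u v => simp; ring
    | add s t hs ht => simp only [map_add, hs, ht, add_mul]
  rw [hopfAd, key, HopfAlgebra.mul_antipode_lTensor_comul_apply, AlgHom.commutes,
    Algebra.algebraMap_self_apply]

theorem hopfAd_add {A : Type*} [Ring A] [HopfAlgebra ℂ A] (a a' b : A) :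
    hopfAd (a + a') b = hopfAd a b + hopfAd a' b := by
  simp [hopfAd]

theorem hopfAd_smul {A : Type*} [Ring A] [HopfAlgebra ℂ A] (c : ℂ) (a b : A) :
    hopfAd (c • a) b = c • hopfAd a b := by
  simp [hopfAd]

/-- The condition on two consecutive terms of a solvable series. -/
def IsSolvableStep {A : Type*} [Ring A] [HopfAlgebra ℂ A] (L M : Subalgebra ℂ A) : Prop :=
  ∃ l : A, IsNormalizedIntegral L l ∧ (l ∈ M ∧ ∀ x ∈ M, l * x = x * l) ∧
    ∀ a ∈ M, ∀ b ∈ M, hopfAd a b * l = Coalgebra.counit (R := ℂ) a • (b * l)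

theorem isSolvableSeries_four {A : Type*} [Ring A] [HopfAlgebra ℂ A] {L : Fin 4 → Subalgebra ℂ A}
    (hL : ∀ j, IsLeftCoidealSubalgebra (L j)) (h01 : L 0 < L 1) (h12 : L 1 < L 2)
    (h23 : L 2 < L 3) (s01 : IsSolvableStep (L 0) (L 1)) (s12 : IsSolvableStep (L 1) (L 2))
    (s23 : IsSolvableStep (L 2) (L 3)) : IsSolvableSeries (n := 3) L where
  leftCoideal := hL
  strictMono := by
    rw [Fin.strictMono_iff_lt_succ]
    intro i
    fin_cases i
    exacts [h01, h12, h23]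
  step j := by
    fin_cases j
    exacts [s01, s12, s23]

namespace KacPaljutkin

/-! ### Coideal property and order read off from index sets -/

theorem isLeftCoidealSubalgebra_of_toSubmodule_eq {L : Subalgebra ℂ KacPaljutkin}
    {S : Finset (Fin 8)} (hS : S ∈ coidealIndexSets)
    (hL : Subalgebra.toSubmodule L = coordSubmodule S) : IsLeftCoidealSubalgebra L := by
  rw [isLeftCoidealSubalgebra_iff]
  intro x hx i
  rw [← Subalgebra.mem_toSubmodule, hL] at hx ⊢
  -- Being a union of columns in the matrix block is all that the coideal condition needs;
  -- group-likes impose nothing.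
  have hS' : (4 ∈ S ↔ 6 ∈ S) ∧ (5 ∈ S ↔ 7 ∈ S) := by
    clear hx hL
    revert S
    decide +kernel
  have H : ∀ i j, (i ∈ S → j ∈ S) → coord x i • cobasis j ∈ coordSubmodule S := by
    intro i j hij
    by_cases hi : i ∈ S
    · exact Submodule.smul_mem _ _ (cobasis_mem_coordSubmodule.2 (hij hi))
    · rw [hx i hi, zero_smul]
      exact Submodule.zero_mem _
  fin_cases i
  · exact H 0 0 id
  · exact H 1 1 id
  · exact H 2 2 id
  · exact H 3 3 id
  · exact Submodule.add_mem _ (H 4 4 id) (H 5 5 id)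
  · exact Submodule.add_mem _ (H 4 6 hS'.1.1) (H 5 7 hS'.2.1)
  · exact Submodule.add_mem _ (H 6 4 hS'.1.2) (H 7 5 hS'.2.2)
  · exact Submodule.add_mem _ (H 6 6 id) (H 7 7 id)

theorem lt_iff_of_toSubmodule_eq {L M : Subalgebra ℂ KacPaljutkin} {S T : Finset (Fin 8)}
    (hL : Subalgebra.toSubmodule L = coordSubmodule S)
    (hM : Subalgebra.toSubmodule M = coordSubmodule T) : L < M ↔ S ⊂ T := by
  have H : ∀ {L M : Subalgebra ℂ KacPaljutkin} {S T : Finset (Fin 8)},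
      Subalgebra.toSubmodule L = coordSubmodule S → Subalgebra.toSubmodule M = coordSubmodule T →
      (L ≤ M ↔ S ⊆ T) := fun hL hM => by
    rw [← coordSubmodule_le_coordSubmodule, ← hL, ← hM]
    exact Iff.rfl
  rw [lt_iff_le_not_ge, H hL hM, H hM hL]
  rfl

/-! ### Integrals -/

theorem counit_e1 : Coalgebra.counit (R := ℂ) e1 = 1 := lift_e1 ..
theorem counit_e2 : Coalgebra.counit (R := ℂ) e2 = 0 := lift_e2 ..
theorem counit_e3 : Coalgebra.counit (R := ℂ) e3 = 0 := lift_e3 ..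
theorem counit_e4 : Coalgebra.counit (R := ℂ) e4 = 0 := lift_e4 ..
theorem counit_a11 : Coalgebra.counit (R := ℂ) a11 = 0 := lift_a11 ..
theorem counit_a12 : Coalgebra.counit (R := ℂ) a12 = 0 := lift_a12 ..
theorem counit_a21 : Coalgebra.counit (R := ℂ) a21 = 0 := lift_a21 ..
theorem counit_a22 : Coalgebra.counit (R := ℂ) a22 = 0 := lift_a22 ..

/-- The integral equations are linear in `x`. In each application the integral is the spanning
vector on which the counit does not vanish. -/
theorem isNormalizedIntegral_of_span {L : Subalgebra ℂ KacPaljutkin} {s : Set KacPaljutkin}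
    (hL : Subalgebra.toSubmodule L = Submodule.span ℂ s) {l : KacPaljutkin} (hl : l ∈ s)
    (hmul : ∀ x ∈ s, l * x = Coalgebra.counit (R := ℂ) x • l ∧
      x * l = Coalgebra.counit (R := ℂ) x • l)
    (hl1 : Coalgebra.counit (R := ℂ) l = 1) : IsNormalizedIntegral L l := by
  have H : ∀ x ∈ L, l * x = Coalgebra.counit (R := ℂ) x • l ∧
      x * l = Coalgebra.counit (R := ℂ) x • l := by
    intro x hx
    rw [← Subalgebra.mem_toSubmodule, hL] at hx
    induction hx using Submodule.span_induction with
    | mem x hx => exact hmul x hx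
    | zero => simp
    | add x y _ _ hx hy =>
      simp only [mul_add, add_mul, map_add, add_smul, hx.1, hy.1, hx.2, hy.2, and_self]
    | smul c x _ hx =>
      simp only [mul_smul_comm, smul_mul_assoc, map_smul, hx.1, hx.2, smul_assoc, and_self]
  refine ⟨?_, fun x hx => (H x hx).1, fun x hx => (H x hx).2, hl1⟩
  rw [← Subalgebra.mem_toSubmodule, hL]
  exact Submodule.subset_span hl

theorem isNormalizedIntegral_bot :
    IsNormalizedIntegral (⊥ : Subalgebra ℂ KacPaljutkin) 1 := by
  refine isNormalizedIntegral_of_span (s := {1}) ?_ rfl ?_ (Bialgebra.counit_one)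
  · rw [Algebra.toSubmodule_bot, Submodule.one_eq_span]
  · rintro x rfl
    simp

theorem isNormalizedIntegral_L2 : IsNormalizedIntegral L2 (e1 + e2) := by
  refine isNormalizedIntegral_of_span rfl (by simp) ?_ (by simp [counit_e1, counit_e2])
  rintro x (rfl | rfl | rfl | rfl) <;>
    simp only [map_add, map_sub, map_smul, counit_e1, counit_e2, counit_e3, counit_e4,
      counit_a11, counit_a12, counit_a21, counit_a22] <;>
    simp [e1, e2, e3, e4, a11, a12, a21, a22, mul_add, add_mul, mul_sub, sub_mul,
      e_mul_e, e_mul_a, a_mul_e]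

theorem isNormalizedIntegral_L3 : IsNormalizedIntegral L3 (e1 + e3) := by
  refine isNormalizedIntegral_of_span rfl (by simp) ?_ (by simp [counit_e1, counit_e3])
  rintro x (rfl | rfl | rfl | rfl) <;>
    simp only [map_add, map_smul, counit_e1, counit_e2, counit_e3, counit_e4,
      counit_a11, counit_a12, counit_a21, counit_a22] <;>
    simp [e1, e2, e3, e4, a11, a12, a21, a22, mul_add, add_mul, e_mul_e, e_mul_a, a_mul_e]

theorem isNormalizedIntegral_L4 : IsNormalizedIntegral L4 (e1 + e4) := by
  refine isNormalizedIntegral_of_span rfl (by simp) ?_ (by simp [counit_e1, counit_e4])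
  rintro x (rfl | rfl | rfl | rfl) <;>
    simp only [map_add, counit_e1, counit_e2, counit_e3, counit_e4, counit_a11, counit_a22] <;>
    simp [e1, e2, e3, e4, a11, a22, mul_add, add_mul, e_mul_e, e_mul_a, a_mul_e]

theorem isNormalizedIntegral_L5 : IsNormalizedIntegral L5 (e1 + e2 + e3 + e4) := by
  refine isNormalizedIntegral_of_span rfl (by simp) ?_
    (by simp [counit_e1, counit_e2, counit_e3, counit_e4])
  rintro x (rfl | rfl) <;>
    simp only [map_add, counit_e1, counit_e2, counit_e3, counit_e4, counit_a11, counit_a22] <;>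
    simp [e1, e2, e3, e4, a11, a22, mul_add, add_mul, e_mul_e, e_mul_a, a_mul_e]

theorem isNormalizedIntegral_L6 : IsNormalizedIntegral L6 (e1 + e4 + a11) := by
  refine isNormalizedIntegral_of_span rfl (by simp) ?_
    (by simp [counit_e1, counit_e4, counit_a11])
  rintro x (rfl | rfl) <;>
    simp only [map_add, counit_e1, counit_e2, counit_e3, counit_e4, counit_a11, counit_a22] <;>
    simp [e1, e2, e3, e4, a11, a22, mul_add, add_mul, e_mul_e, e_mul_a, a_mul_e, a_mul_a]

theorem isNormalizedIntegral_L7 : IsNormalizedIntegral L7 (e1 + e4 + a22) := by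
  refine isNormalizedIntegral_of_span rfl (by simp) ?_
    (by simp [counit_e1, counit_e4, counit_a22])
  rintro x (rfl | rfl) <;>
    simp only [map_add, counit_e1, counit_e2, counit_e3, counit_e4, counit_a11, counit_a22] <;>
    simp [e1, e2, e3, e4, a11, a22, mul_add, add_mul, e_mul_e, e_mul_a, a_mul_e, a_mul_a]

/-! ### Solvable steps -/

/-- The projection onto the `j`-th one-dimensional summand. -/
def character (j : Fin 4) : KacPaljutkin →ₐ[ℂ] ℂ where
  toFun x := x.1 j
  map_one' := rfl
  map_mul' _ _ := rfl
  map_zero' := rfl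
  map_add' _ _ := rfl
  commutes' _ := rfl

/-- The line through `e j` is an ideal on which the algebra acts by a character; with `e_mul` this
makes `e j` central. -/
theorem mul_e (x : KacPaljutkin) (j : Fin 4) : x * e j = character j x • e j := by
  refine Prod.ext ?_ (mul_zero x.2 |>.trans (smul_zero (character j x)).symm)
  change x.1 * Pi.single j 1 = x.1 j • Pi.single j 1
  ext i
  by_cases hi : i = j
  · subst hi; simp
  · simp [hi]

theorem e_mul (x : KacPaljutkin) (j : Fin 4) : e j * x = character j x • e j := by
  refine Prod.ext ?_ (zero_mul x.2 |>.trans (smul_zero (character j x)).symm)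
  change Pi.single j 1 * x.1 = x.1 j • Pi.single j 1
  ext i
  by_cases hi : i = j
  · subst hi; simp
  · simp [hi]

/-- Multiplying by `e j` only sees `character j`, under which the adjoint action becomes the counit.
Both conditions therefore hold in the whole algebra, whatever `M` is. -/
theorem isSolvableStep_of_sum_e {L M : Subalgebra ℂ KacPaljutkin} (hLM : L ≤ M)
    {J : Finset (Fin 4)} (hl : IsNormalizedIntegral L (∑ j ∈ J, e j)) : IsSolvableStep L M := by
  refine ⟨_, hl, ⟨hLM hl.mem, fun x _ => ?_⟩, fun x _ y _ => ?_⟩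
  · simp only [Finset.sum_mul, Finset.mul_sum, mul_e, e_mul]
  · simp only [Finset.mul_sum, mul_e, AlgHom.map_hopfAd, Finset.smul_sum, smul_smul]

theorem isSolvableStep_L2_top : IsSolvableStep L2 ⊤ :=
  isSolvableStep_of_sum_e (J := {0, 1}) le_top
    (by simpa [e1, e2] using isNormalizedIntegral_L2)

theorem isSolvableStep_L3_top : IsSolvableStep L3 ⊤ :=
  isSolvableStep_of_sum_e (J := {0, 2}) le_top
    (by simpa [e1, e3] using isNormalizedIntegral_L3)

theorem isSolvableStep_L4_top : IsSolvableStep L4 ⊤ :=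
  isSolvableStep_of_sum_e (J := {0, 3}) le_top
    (by simpa [e1, e4] using isNormalizedIntegral_L4)

theorem isSolvableStep_L5 {M : Subalgebra ℂ KacPaljutkin} (hM : L5 ≤ M) : IsSolvableStep L5 M :=
  isSolvableStep_of_sum_e (J := Finset.univ) hM
    (by simpa [Fin.sum_univ_four, e1, e2, e3, e4] using isNormalizedIntegral_L5)

theorem mul_comm_of_mem_L4 {x y : KacPaljutkin} (hx : x ∈ L4) (hy : y ∈ L4) : x * y = y * x := by
  have H : ∀ z ∈ L4, ∃ u v w t : ℂ,
      z = u • (e1 + e4) + (v • (e2 + e3) + (w • a11 + t • a22)) := by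
    intro z hz
    change z ∈ Submodule.span ℂ _ at hz
    simp only [Submodule.mem_span_insert, Submodule.mem_span_singleton] at hz
    obtain ⟨u, _, ⟨v, _, ⟨w, _, ⟨t, rfl⟩, rfl⟩, rfl⟩, rfl⟩ := hz
    exact ⟨u, v, w, t, rfl⟩
  obtain ⟨u, v, w, t, rfl⟩ := H x hx
  obtain ⟨u', v', w', t', rfl⟩ := H y hy
  simp only [e1, e2, e3, e4, a11, a22, mul_add, add_mul, smul_add, smul_mul_assoc, mul_smul_comm,
    e_mul_e, e_mul_a, a_mul_e, a_mul_a, reduceIte, Fin.reduceEq]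
  module

/-- A group-like involution fixed by the antipode acts by the conjugation `x * y * x`, which is
trivial because `L4` is commutative. -/
theorem hopfAd_of_comul_eq_tmul_self {x y : KacPaljutkin} (hx : x ∈ L4)
    (hc : Coalgebra.comul (R := ℂ) x = x ⊗ₜ x) (hS : antipodeMap x = x) (hxx : x * x = 1)
    (hy : y ∈ L4) : hopfAd x y = y := by
  have : HopfAlgebra.antipode ℂ x = x := hS
  simp [hopfAd, hc, this, mul_comm_of_mem_L4 hx hy, mul_assoc, hxx]

theorem hopfAd_of_mem_L4 {x y : KacPaljutkin} (hx : x ∈ L4) (hy : y ∈ L4) :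
    hopfAd x y = Coalgebra.counit (R := ℂ) x • y := by
  -- For fixed `y` the identity is linear in `x`, so it suffices to check the four group-likes
  -- spanning `L4`.
  let K : Submodule ℂ KacPaljutkin :=
    { carrier := {x | hopfAd x y = Coalgebra.counit (R := ℂ) x • y}
      add_mem' := fun {a b} ha hb => by
        simp only [Set.mem_ofPred_eq] at ha hb ⊢
        rw [hopfAd_add, ha, hb, map_add, add_smul]
      zero_mem' := by simp [hopfAd]
      smul_mem' := fun c a ha => by
        simp only [Set.mem_ofPred_eq] at ha ⊢
        rw [hopfAd_smul, ha, map_smul, smul_assoc] }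
  have hK : coordSubmodule {0, 1, 2, 3} ≤ K := by
    rw [coordSubmodule_le_iff]
    intro i hi
    have hmem : cobasis i ∈ L4 := by
      rw [← Subalgebra.mem_toSubmodule, toSubmodule_L4]
      exact cobasis_mem_coordSubmodule.2 hi
    have hε : Coalgebra.counit (R := ℂ) (cobasis i) = 1 := by
      fin_cases i <;> simp at hi <;>
        simp [cobasis, g, h, k, counit_e1, counit_e2, counit_e3, counit_e4, counit_a11, counit_a22]
    change hopfAd _ y = Coalgebra.counit (R := ℂ) _ • y
    rw [hε, one_smul]
    refine hopfAd_of_comul_eq_tmul_self hmem ?_ ?_ ?_ hy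
    · rw [comul_cobasis]
      fin_cases i <;> first | rfl | simp at hi
    · fin_cases i <;> simp at hi <;>
        simp [cobasis, one_eq, g, h, k, antipodeMap, e1, e2, e3, e4, a11, a22, lift_e1, lift_e2,
          lift_e3, lift_e4, lift_a11, lift_a22]
    · fin_cases i <;> simp at hi
      · exact mul_one 1
      all_goals
        simp only [cobasis, Matrix.cons_val, Fin.reduceFinMk, Fin.mk_one, one_eq, g, h, k, e1, e2,
          e3, e4, a11, a22, mul_add, add_mul, mul_sub, sub_mul, e_mul_e, e_mul_a, a_mul_e,
          a_mul_a, reduceIte, Fin.reduceEq]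
        module
  refine hK ?_
  rwa [← toSubmodule_L4]

theorem isSolvableStep_of_le_L4 {L M : Subalgebra ℂ KacPaljutkin} (hLM : L ≤ M) (hM : M ≤ L4)
    {l : KacPaljutkin} (hl : IsNormalizedIntegral L l) : IsSolvableStep L M :=
  ⟨l, hl, ⟨hLM hl.mem, fun x hx => mul_comm_of_mem_L4 (hM (hLM hl.mem)) (hM hx)⟩,
    fun x hx y hy => by rw [hopfAd_of_mem_L4 (hM hx) (hM hy), smul_mul_assoc]⟩

/-! ### The solvable series of length four -/

theorem bot_lt_L5 : ⊥ < L5 :=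
  (lt_iff_of_toSubmodule_eq toSubmodule_bot_eq_coordSubmodule toSubmodule_L5).2 (by decide)
theorem bot_lt_L6 : ⊥ < L6 :=
  (lt_iff_of_toSubmodule_eq toSubmodule_bot_eq_coordSubmodule toSubmodule_L6).2 (by decide)
theorem bot_lt_L7 : ⊥ < L7 :=
  (lt_iff_of_toSubmodule_eq toSubmodule_bot_eq_coordSubmodule toSubmodule_L7).2 (by decide)
theorem L5_lt_L2 : L5 < L2 :=
  (lt_iff_of_toSubmodule_eq toSubmodule_L5 toSubmodule_L2).2 (by decide)
theorem L5_lt_L3 : L5 < L3 :=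
  (lt_iff_of_toSubmodule_eq toSubmodule_L5 toSubmodule_L3).2 (by decide)
theorem L5_lt_L4 : L5 < L4 :=
  (lt_iff_of_toSubmodule_eq toSubmodule_L5 toSubmodule_L4).2 (by decide)
theorem L6_lt_L4 : L6 < L4 :=
  (lt_iff_of_toSubmodule_eq toSubmodule_L6 toSubmodule_L4).2 (by decide)
theorem L7_lt_L4 : L7 < L4 :=
  (lt_iff_of_toSubmodule_eq toSubmodule_L7 toSubmodule_L4).2 (by decide)
theorem L2_lt_top : L2 < ⊤ :=
  (lt_iff_of_toSubmodule_eq toSubmodule_L2 toSubmodule_top_eq_coordSubmodule).2 (by decide)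
theorem L3_lt_top : L3 < ⊤ :=
  (lt_iff_of_toSubmodule_eq toSubmodule_L3 toSubmodule_top_eq_coordSubmodule).2 (by decide)
theorem L4_lt_top : L4 < ⊤ :=
  (lt_iff_of_toSubmodule_eq toSubmodule_L4 toSubmodule_top_eq_coordSubmodule).2 (by decide)

theorem isLeftCoidealSubalgebra_bot : IsLeftCoidealSubalgebra (⊥ : Subalgebra ℂ KacPaljutkin) :=
  isLeftCoidealSubalgebra_of_toSubmodule_eq (by decide) toSubmodule_bot_eq_coordSubmodule
theorem isLeftCoidealSubalgebra_top : IsLeftCoidealSubalgebra (⊤ : Subalgebra ℂ KacPaljutkin) :=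
  isLeftCoidealSubalgebra_of_toSubmodule_eq (by decide) toSubmodule_top_eq_coordSubmodule
theorem isLeftCoidealSubalgebra_L2 : IsLeftCoidealSubalgebra L2 :=
  isLeftCoidealSubalgebra_of_toSubmodule_eq (by decide) toSubmodule_L2
theorem isLeftCoidealSubalgebra_L3 : IsLeftCoidealSubalgebra L3 :=
  isLeftCoidealSubalgebra_of_toSubmodule_eq (by decide) toSubmodule_L3
theorem isLeftCoidealSubalgebra_L4 : IsLeftCoidealSubalgebra L4 :=
  isLeftCoidealSubalgebra_of_toSubmodule_eq (by decide) toSubmodule_L4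
theorem isLeftCoidealSubalgebra_L5 : IsLeftCoidealSubalgebra L5 :=
  isLeftCoidealSubalgebra_of_toSubmodule_eq (by decide) toSubmodule_L5
theorem isLeftCoidealSubalgebra_L6 : IsLeftCoidealSubalgebra L6 :=
  isLeftCoidealSubalgebra_of_toSubmodule_eq (by decide) toSubmodule_L6
theorem isLeftCoidealSubalgebra_L7 : IsLeftCoidealSubalgebra L7 :=
  isLeftCoidealSubalgebra_of_toSubmodule_eq (by decide) toSubmodule_L7

/-- The integral of `⊥` is `1`, so the first step asks for a trivial adjoint action on all of `M`.
The hypothesis `M ≤ L4` supplies it. -/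
theorem isSolvableSeries_of_bot_top {M N : Subalgebra ℂ KacPaljutkin}
    (hM : IsLeftCoidealSubalgebra M) (hN : IsLeftCoidealSubalgebra N) (h01 : ⊥ < M) (h12 : M < N)
    (h23 : N < ⊤) (hM4 : M ≤ L4) (s12 : IsSolvableStep M N) (s23 : IsSolvableStep N ⊤) :
    IsSolvableSeries (n := 3) ![⊥, M, N, ⊤] := by
  refine isSolvableSeries_four (fun j => ?_) h01 h12 h23
    (isSolvableStep_of_le_L4 h01.le hM4 isNormalizedIntegral_bot) s12 s23
  fin_cases j
  exacts [isLeftCoidealSubalgebra_bot, hM, hN, isLeftCoidealSubalgebra_top]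

-- In the poset of eight index sets no strict chain has more than four terms, so those with four are
-- maximal and contain both extreme sets.
set_option synthInstance.maxSize 1000 in
set_option synthInstance.maxHeartbeats 200000 in
theorem coidealIndexSets_chain : ∀ S₀ ∈ coidealIndexSets, ∀ S₁ ∈ coidealIndexSets, S₀ ⊂ S₁ →
    ∀ S₂ ∈ coidealIndexSets, S₁ ⊂ S₂ → ∀ S₃ ∈ coidealIndexSets, S₂ ⊂ S₃ →
    S₀ = {0} ∧ S₃ = Finset.univ ∧
      (S₁ = {0, 1} ∧ S₂ = {0, 1, 4, 6} ∨ S₁ = {0, 1} ∧ S₂ = {0, 1, 5, 7} ∨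
        S₁ = {0, 1} ∧ S₂ = {0, 1, 2, 3} ∨ S₁ = {0, 2} ∧ S₂ = {0, 1, 2, 3} ∨
        S₁ = {0, 3} ∧ S₂ = {0, 1, 2, 3}) := by
  decide +kernel

/-- The strictly increasing chains of four left coideal subalgebras. -/
theorem eq_of_strictMono {L : Fin 4 → Subalgebra ℂ KacPaljutkin}
    (hL : ∀ j, IsLeftCoidealSubalgebra (L j)) (hmono : StrictMono L) :
    L = ![⊥, L5, L2, ⊤] ∨ L = ![⊥, L5, L3, ⊤] ∨ L = ![⊥, L5, L4, ⊤] ∨ L = ![⊥, L6, L4, ⊤] ∨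
      L = ![⊥, L7, L4, ⊤] := by
  choose S hS hLS using fun j => exists_toSubmodule_eq_coordSubmodule (hL j)
  have hlt : ∀ {i j}, i < j → S i ⊂ S j := fun {i j} hij =>
    (lt_iff_of_toSubmodule_eq (hLS i) (hLS j)).1 (hmono hij)
  have H : ∀ {j T} {M : Subalgebra ℂ KacPaljutkin}, S j = T →
      Subalgebra.toSubmodule M = coordSubmodule T → L j = M := fun hj hM =>
    Subalgebra.toSubmodule_injective ((hLS _).trans (hj ▸ hM.symm))
  have ext4 : ∀ {M N : Subalgebra ℂ KacPaljutkin}, L 0 = ⊥ → L 1 = M → L 2 = N → L 3 = ⊤ →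
      L = ![⊥, M, N, ⊤] := fun h0 h1 h2 h3 => by
    ext1 j
    fin_cases j
    exacts [h0, h1, h2, h3]
  obtain ⟨h0, h3, hM⟩ := coidealIndexSets_chain _ (hS 0) _ (hS 1) (hlt (by decide)) _ (hS 2)
    (hlt (by decide)) _ (hS 3) (hlt (by decide))
  have ext' : ∀ {M N : Subalgebra ℂ KacPaljutkin}, L 1 = M → L 2 = N → L = ![⊥, M, N, ⊤] :=
    fun hM hN => ext4 (H h0 toSubmodule_bot_eq_coordSubmodule) hM hN
      (H h3 toSubmodule_top_eq_coordSubmodule)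
  rcases hM with ⟨h1, h2⟩ | ⟨h1, h2⟩ | ⟨h1, h2⟩ | ⟨h1, h2⟩ | ⟨h1, h2⟩
  · exact Or.inl (ext' (H h1 toSubmodule_L5) (H h2 toSubmodule_L2))
  · exact Or.inr (Or.inl (ext' (H h1 toSubmodule_L5) (H h2 toSubmodule_L3)))
  · exact Or.inr (Or.inr (Or.inl (ext' (H h1 toSubmodule_L5) (H h2 toSubmodule_L4))))
  · exact Or.inr (Or.inr (Or.inr (Or.inl (ext' (H h1 toSubmodule_L6) (H h2 toSubmodule_L4)))))
  · exact Or.inr (Or.inr (Or.inr (Or.inr (ext' (H h1 toSubmodule_L7) (H h2 toSubmodule_L4)))))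

theorem ne_of_toSubmodule_eq {L M : Subalgebra ℂ KacPaljutkin} {S T : Finset (Fin 8)}
    (hL : Subalgebra.toSubmodule L = coordSubmodule S)
    (hM : Subalgebra.toSubmodule M = coordSubmodule T) (hST : ¬ S ⊆ T) : L ≠ M := by
  rintro rfl
  exact hST (coordSubmodule_le_coordSubmodule.1 (hL.symm.trans hM).le)

end KacPaljutkin

/-! ### The theorem -/

open KacPaljutkin in
theorem mainTheorem3 :
    {L : Fin 4 → Subalgebra ℂ KacPaljutkin | IsSolvableSeries (n := 3) L} =
      {![⊥, L5, L2, ⊤], ![⊥, L5, L3, ⊤], ![⊥, L5, L4, ⊤], ![⊥, L6, L4, ⊤], ![⊥, L7, L4, ⊤]} ∧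
    {L : Fin 4 → Subalgebra ℂ KacPaljutkin | IsSolvableSeries (n := 3) L}.ncard = 5 := by
  have key : {L : Fin 4 → Subalgebra ℂ KacPaljutkin | IsSolvableSeries (n := 3) L} =
      {![⊥, L5, L2, ⊤], ![⊥, L5, L3, ⊤], ![⊥, L5, L4, ⊤], ![⊥, L6, L4, ⊤],
        ![⊥, L7, L4, ⊤]} := by
    ext L
    -- Strict monotonicity and the coideal property already force one of the five chains; the
    -- solvability conditions are not needed in this direction.
    refine ⟨fun hL => eq_of_strictMono hL.leftCoideal hL.strictMono, ?_⟩
    rintro (rfl | rfl | rfl | rfl | rfl)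
    · exact isSolvableSeries_of_bot_top isLeftCoidealSubalgebra_L5 isLeftCoidealSubalgebra_L2
        bot_lt_L5 L5_lt_L2 L2_lt_top L5_lt_L4.le (isSolvableStep_L5 L5_lt_L2.le) isSolvableStep_L2_top
    · exact isSolvableSeries_of_bot_top isLeftCoidealSubalgebra_L5 isLeftCoidealSubalgebra_L3
        bot_lt_L5 L5_lt_L3 L3_lt_top L5_lt_L4.le (isSolvableStep_L5 L5_lt_L3.le) isSolvableStep_L3_top
    · exact isSolvableSeries_of_bot_top isLeftCoidealSubalgebra_L5 isLeftCoidealSubalgebra_L4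
        bot_lt_L5 L5_lt_L4 L4_lt_top L5_lt_L4.le (isSolvableStep_L5 L5_lt_L4.le) isSolvableStep_L4_top
    · exact isSolvableSeries_of_bot_top isLeftCoidealSubalgebra_L6 isLeftCoidealSubalgebra_L4
        bot_lt_L6 L6_lt_L4 L4_lt_top L6_lt_L4.le
        (isSolvableStep_of_le_L4 L6_lt_L4.le le_rfl isNormalizedIntegral_L6) isSolvableStep_L4_top
    · exact isSolvableSeries_of_bot_top isLeftCoidealSubalgebra_L7 isLeftCoidealSubalgebra_L4
        bot_lt_L7 L7_lt_L4 L4_lt_top L7_lt_L4.le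
        (isSolvableStep_of_le_L4 L7_lt_L4.le le_rfl isNormalizedIntegral_L7) isSolvableStep_L4_top
  refine ⟨key, ?_⟩
  -- Any two of the chains differ in the second or third term, so these inequalities separate all
  -- five.
  have h23 : L2 ≠ L3 := ne_of_toSubmodule_eq toSubmodule_L2 toSubmodule_L3 (by decide)
  have h24 : L2 ≠ L4 := ne_of_toSubmodule_eq toSubmodule_L2 toSubmodule_L4 (by decide)
  have h34 : L3 ≠ L4 := ne_of_toSubmodule_eq toSubmodule_L3 toSubmodule_L4 (by decide)
  have h56 : L5 ≠ L6 := ne_of_toSubmodule_eq toSubmodule_L5 toSubmodule_L6 (by decide)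
  have h57 : L5 ≠ L7 := ne_of_toSubmodule_eq toSubmodule_L5 toSubmodule_L7 (by decide)
  have h67 : L6 ≠ L7 := ne_of_toSubmodule_eq toSubmodule_L6 toSubmodule_L7 (by decide)
  rw [key, Set.ncard_insert_of_notMem, Set.ncard_insert_of_notMem, Set.ncard_insert_of_notMem,
    Set.ncard_pair]
  all_goals simp [h23, h24, h34, h56, h57, h67]
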